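/- Let \(R\) be a non-zero commutative ring and \(\tau\colon H\to G\) a homomorphism of groups. An \(R\)-linear category \(\mathcal C\) is \(H\)-Hom-graded if every hom-module is a direct sum \(\operatorname{Hom}(X,Y)=\bigoplus_{h\in H}\operatorname{Hom}^h(X,Y)\), identities have degree \(1\), and the composite \(f'\circ f\) of \(f'\) of degree \(h'\) and \(f\) of degree \(h\) has degree \(h'h\); \(\mathcal C^1\) denotes the subcategory of degree \(1\) morphisms. It is \(\tau\)-graded if in addition \(\mathcal C^1\) has pairwise disjoint full subcategories \((\mathcal C_g)_{g\in G}\) (closed under isomorphism and containing the zero objects; disjoint means that all morphisms between them vanish) such that every object is a direct sum in \(\mathcal C^1\) of finitely many components \(X_g\in\mathcal C_g\), and \(\operatorname{Hom}^h(X,Y)=0\) for \(X\in\mathcal C_x\), \(Y\in\mathcal C_y\) unless \(y=\tau(h)x\). For a non-zero \(X\in\mathcal C_g\) write \(|X|=g\). A \(\tau\)-graded functor is an \(R\)-linear functor preserving the degrees of morphisms and of homogeneous objects; a \(\tau\)-graded equivalence is a pair of \(\tau\)-graded functors mutually inverse up to natural isomorphisms with components of degree \(1\). A shift of \(X\) by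 \(a\in H\) is an object \(X\langle a\rangle\) with an isomorphism \(X\to X\langle a\rangle\) of degree \(a\). An object \(S\) is simple if \(\operatorname{End}_{\mathcal C^1}(S)\cong R\). The category \(\mathcal C\) is semisimple if every object has a shift by every \(a\in H\), and \(\mathcal C^1\) has all finite direct sums and a collection of mutually disjoint simple objects (all morphisms between two different ones vanish) such that every object is a finite direct sum of members of the collection. For a subgroup \(L\le\ker\tau\), a normalised 2-cocycle is a map \(\psi\colon H^2\to\operatorname{Hom}_{\mathrm{Set}}(H/L,R^\times)\) with \(\psi(1,h)=\psi(h,1)=1\) and \(\psi(b,c)(x)\,\psi(ab,c)(x)^{-1}\,\psi(a,bc)(x)\,\psi(a,b)(cx)^{-1}=1\) for all \(a,b,c\in H\), \(x\in H/L\). For \(g\in G\) let \(\mathcal S_\tau(L,\psi)\langle g\rangle\) be the \(\tau\)-graded category with objects \(R_x\) (\(x\in H/L\)), where \(|R_{hL}|=\tau(h)g\), with \(\operatorname{Hom}^a(R_x,R_y)\) free over \(R\) on one generator \(e^a_x\) if \(ax=y\) and zero otherwise, with \(e^1_x=\mathrm{id}\), and with \(e^a_{bx}\circ e^b_x=\psi(a,b)(x)^{-1}e^{ab}_x\).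 Let \(\mathcal M_\tau(L,\psi)\langle g\rangle\) be its completion under finite direct sums. The direct sum \(\boxplus_{i\in I}\mathcal C_i\) has as objects the families \((X_i)_{i\in I}\), \(X_i\in\mathcal C_i\), with finitely many non-zero members, and componentwise morphisms and degrees. **Theorem.** A \(\tau\)-graded category \(\mathcal C\) is semisimple if and only if there is a \(\tau\)-graded equivalence \[\mathcal C\simeq\boxplus_{i\in I}\mathcal M_\tau(L_i,\psi_i)\langle g_i\rangle\] for some set \(I\), subgroups \(L_i\le\ker\tau\), normalised 2-cocycles \(\psi_i\colon H^2\to\operatorname{Hom}_{\mathrm{Set}}(H/L_i,R^\times)\) and elements \(g_i\in G\). Moreover, let \(\mathcal C\) be semisimple and let \((S_i)_{i\in I}\) be a representative collection of the simple objects of \(\mathcal C\) up to isomorphism of arbitrary degree. Then every \(S_i\) is homogeneous and \(L_{S_i}=\{a\in H : S_i\langle a\rangle\cong S_i\text{ in }\mathcal C^1\}\) is contained in \(\ker\tau\). For \(S=S_i\) one can choose representatives \(h_x\in x\) of the cosets \(x\in H/L_S\), shifts \(S\langle h_x\rangle\), and morphisms \(f^a_x\) spanning \(\operatorname{Hom}^a(S\langle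 h_x\rangle,S\langle h_{ax}\rangle)\) for all \(a\in H\), with \(f^1_x=\mathrm{id}\). For every such choice there is exactly one normalised 2-cocycle \(\psi_S\colon H^2\to\operatorname{Hom}_{\mathrm{Set}}(H/L_S,R^\times)\) with \(f^{ab}_x=\psi_S(a,b)(x)\, f^a_{bx}\circ f^b_x\) for all \(a,b,x\). For all such choices the equivalence above exists with \(g_i=|S_i|\), \(L_i=L_{S_i}\) and \(\psi_i=\psi_{S_i}\). -/

import Mathlib

open CategoryTheory CategoryTheory.Limits

universe w v u uR uH uG

namespace TauGrad

noncomputable section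

/-! ### Linear categories: finite direct sums and `R`-linear semisimplicity -/

/-- `X` is a direct sum of the finite family `Y`: there are coprojections `ι j` and projections
`π j` with `π i ∘ ι j = δ_ij` and `∑ ι j ∘ π j = id`. -/
def IsDirectSum {D : Type u} [Category.{v} D] [Preadditive D] {J : Type w} [Fintype J]
    (Y : J → D) (X : D) : Prop :=
  ∃ (ι : ∀ j, Y j ⟶ X) (π : ∀ j, X ⟶ Y j),
    (∀ j, ι j ≫ π j = 𝟙 (Y j)) ∧ (∀ j k, j ≠ k → ι j ≫ π k = 0) ∧ ∑ j, π j ≫ ι j = 𝟙 X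

/-- An object of an `R`-linear category is `R`-linear simple if its endomorphisms form a copy
of `R`. (For commutative `R`, a linear isomorphism `End X ≅ R` exists iff an isomorphism of
`R`-algebras does.) -/
def IsLinearSimple (R : Type uR) [CommRing R] {D : Type u} [Category.{v} D] [Preadditive D]
    [Linear R D] (X : D) : Prop :=
  Nonempty ((X ⟶ X) ≃ₗ[R] R)

/-- `R`-linear semisimplicity: all finite direct sums exist, and there is a collection of mutually
disjoint `R`-linear simple objects such that every object is a finite direct sum of them. -/
def IsLinearSemisimple (R : Type uR) [CommRing R] (D : Type u) [Category.{v} D] [Preadditive D]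
    [Linear R D] : Prop :=
  HasFiniteBiproducts D ∧
    ∃ S : Set D, (∀ X ∈ S, IsLinearSimple R X) ∧
      (∀ X ∈ S, ∀ Y ∈ S, X ≠ Y → ∀ f : X ⟶ Y, f = 0) ∧
      ∀ X : D, ∃ (n : ℕ) (Y : Fin n → D), (∀ j, Y j ∈ S) ∧ IsDirectSum Y X

/-! ### Hom-graded categories -/

/-- An `H`-Hom-graded structure on an `R`-linear category: every hom-module is the internal direct
sum of submodules `homDeg h X Y` (`h : H`), identities have degree `1`, and the composite `g ∘ f`
of `f` of degree `h` with `g` of degree `h'` has degree `h' * h`. -/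
class HomGraded (R : Type uR) [CommRing R] (H : Type uH) [Group H] (C : Type u) [Category.{v} C]
    [Preadditive C] [Linear R C] where
  homDeg : H → ∀ X Y : C, Submodule R (X ⟶ Y)
  indep : ∀ X Y : C, iSupIndep fun h => homDeg h X Y
  iSup_eq_top : ∀ X Y : C, ⨆ h, homDeg h X Y = ⊤
  id_mem : ∀ X : C, 𝟙 X ∈ homDeg 1 X X
  comp_mem : ∀ {X Y Z : C} {h h' : H} {f : X ⟶ Y} {g : Y ⟶ Z},
    f ∈ homDeg h X Y → g ∈ homDeg h' Y Z → f ≫ g ∈ homDeg (h' * h) X Z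

section HomGraded

variable (R : Type uR) [CommRing R] {H : Type uH} [Group H] {C : Type u} [Category.{v} C]
  [Preadditive C] [Linear R C] [HomGraded R H C]

/-- The submodule `Hom^h(X, Y)` of morphisms of degree `h`. -/
def homDeg (h : H) (X Y : C) : Submodule R (X ⟶ Y) := HomGraded.homDeg h X Y

variable {R}

lemma id_mem (X : C) : 𝟙 X ∈ homDeg R (1 : H) X X := HomGraded.id_mem X

lemma comp_mem {X Y Z : C} {h h' : H} {f : X ⟶ Y} {g : Y ⟶ Z} (hf : f ∈ homDeg R h X Y)
    (hg : g ∈ homDeg R h' Y Z) : f ≫ g ∈ homDeg R (h' * h) X Z := HomGraded.comp_mem hf hg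

lemma comp_mem_one {X Y Z : C} {f : X ⟶ Y} {g : Y ⟶ Z} (hf : f ∈ homDeg R (1 : H) X Y)
    (hg : g ∈ homDeg R (1 : H) Y Z) : f ≫ g ∈ homDeg R (1 : H) X Z := by
  simpa using comp_mem hf hg

end HomGraded

/-- The category `C¹`: the same objects as `C`, and the morphisms of degree `1`. -/
@[ext]
structure DegOne (R : Type uR) (H : Type uH) (C : Type u) where
  obj : C

section DegOne

variable {R : Type uR} [CommRing R] {H : Type uH} [Group H] {C : Type u} [Category.{v} C]
  [Preadditive C] [Linear R C] [HomGraded R H C]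

instance : Category.{v} (DegOne R H C) where
  Hom X Y := homDeg R (1 : H) X.obj Y.obj
  id X := ⟨𝟙 X.obj, id_mem X.obj⟩
  comp f g := ⟨f.1 ≫ g.1, comp_mem_one f.2 g.2⟩
  id_comp f := Subtype.ext (Category.id_comp f.1)
  comp_id f := Subtype.ext (Category.comp_id f.1)
  assoc f g h := Subtype.ext (Category.assoc f.1 g.1 h.1)

instance (X Y : DegOne R H C) : AddCommGroup (X ⟶ Y) :=
  inferInstanceAs (AddCommGroup (homDeg R (1 : H) X.obj Y.obj))

instance (X Y : DegOne R H C) : Module R (X ⟶ Y) :=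
  inferInstanceAs (Module R (homDeg R (1 : H) X.obj Y.obj))

/-- The underlying morphism of `C`. -/
def DegOne.val {X Y : DegOne R H C} (f : X ⟶ Y) : X.obj ⟶ Y.obj := Subtype.val f

lemma DegOne.val_mem {X Y : DegOne R H C} (f : X ⟶ Y) :
    DegOne.val f ∈ homDeg R (1 : H) X.obj Y.obj := Subtype.property f

/-- A morphism of degree `1` as a morphism of `C¹`. -/
def DegOne.mk' {X Y : DegOne R H C} (f : X.obj ⟶ Y.obj) (hf : f ∈ homDeg R (1 : H) X.obj Y.obj) :
    X ⟶ Y := Subtype.mk f hf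

@[simp] lemma DegOne.val_mk' {X Y : DegOne R H C} (f : X.obj ⟶ Y.obj)
    (hf : f ∈ homDeg R (1 : H) X.obj Y.obj) : DegOne.val (DegOne.mk' f hf) = f := rfl

lemma DegOne.hom_ext {X Y : DegOne R H C} {f g : X ⟶ Y} (h : DegOne.val f = DegOne.val g) :
    f = g := Subtype.ext h

@[simp] lemma DegOne.val_comp {X Y Z : DegOne R H C} (f : X ⟶ Y) (g : Y ⟶ Z) :
    DegOne.val (f ≫ g) = DegOne.val f ≫ DegOne.val g := rfl

@[simp] lemma DegOne.val_id (X : DegOne R H C) : DegOne.val (𝟙 X) = 𝟙 X.obj := rfl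

@[simp] lemma DegOne.val_zero (X Y : DegOne R H C) : DegOne.val (0 : X ⟶ Y) = 0 := rfl

@[simp] lemma DegOne.val_add {X Y : DegOne R H C} (f g : X ⟶ Y) :
    DegOne.val (f + g) = DegOne.val f + DegOne.val g := rfl

@[simp] lemma DegOne.val_smul {X Y : DegOne R H C} (r : R) (f : X ⟶ Y) :
    DegOne.val (r • f) = r • DegOne.val f := rfl

@[simp] lemma DegOne.val_sum {X Y : DegOne R H C} {J : Type w} (s : Finset J) (f : J → (X ⟶ Y)) :
    DegOne.val (∑ j ∈ s, f j) = ∑ j ∈ s, DegOne.val (f j) :=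
  map_sum (homDeg R (1 : H) X.obj Y.obj).subtype f s

instance : Preadditive (DegOne R H C) where
  add_comp _ _ _ _ _ _ := DegOne.hom_ext (by simp)
  comp_add _ _ _ _ _ _ := DegOne.hom_ext (by simp)

instance : Linear R (DegOne R H C) where
  smul_comp _ _ _ _ _ _ := DegOne.hom_ext (by simp)
  comp_smul _ _ _ _ _ _ := DegOne.hom_ext (by simp)

end DegOne

/-! ### Object gradings and `τ`-graded categories -/

/-- A `G`-grading on (the objects of) a linear category `D`: pairwise disjoint full subcategories
`D_g`, given by the predicates `mem g`, such that every object is a direct sum of finitely many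
components `X_g ∈ D_g`, at most one for every `g`. Two subcategories are disjoint if all
morphisms between them vanish. As usual the `D_g` are closed under isomorphism and zero objects
are homogeneous of every degree. -/
structure ObjGrading (G : Type uG) (D : Type u) [Category.{v} D] [Preadditive D] where
  mem : G → ObjectProperty D
  closed : ∀ {g : G} {X Y : D}, (X ≅ Y) → mem g X → mem g Y
  zero : ∀ (g : G) {X : D}, IsZero X → mem g X
  disjoint : ∀ {g g' : G}, g ≠ g' → ∀ {X Y : D}, mem g X → mem g' Y → ∀ f : X ⟶ Y, f = 0
  decomp : ∀ X : D, ∃ (s : Finset G) (Y : s → D), (∀ g : s, mem g (Y g)) ∧ IsDirectSum Y X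

/-- A `τ`-graded category: an `H`-Hom-graded `R`-linear category `C` with a `G`-grading on `C¹`
such that, for `X` of degree `x` and `Y` of degree `y`, `Hom^h(X, Y) = 0` unless `y = τ(h) x`. -/
class TauGraded (R : Type uR) [CommRing R] {H : Type uH} [Group H] {G : Type uG} [Group G]
    (τ : H →* G) (C : Type u) [Category.{v} C] [Preadditive C] [Linear R C]
    [HomGraded R H C] where
  grading : ObjGrading G (DegOne R H C)
  homDeg_eq_bot : ∀ {x y : G} {X Y : C}, grading.mem x ⟨X⟩ → grading.mem y ⟨Y⟩ →
    ∀ h : H, y ≠ τ h * x → homDeg R h X Y = ⊥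

section TauGraded

variable (R : Type uR) [CommRing R] {H : Type uH} [Group H] {G : Type uG} [Group G]
  (τ : H →* G)

/-- `X` is homogeneous of degree `g`. For a nonzero `X` there is at most one such `g`, the
degree `|X|`. -/
def HasDegree {C : Type u} [Category.{v} C] [Preadditive C] [Linear R C] [HomGraded R H C]
    [TauGraded R τ C] (g : G) (X : C) : Prop :=
  (TauGraded.grading (R := R) (τ := τ) (C := C)).mem g ⟨X⟩

/-- A `τ`-graded functor: `R`-linear, preserving the degrees of morphisms and of homogeneous
objects. -/
structure IsTauFunctor {C : Type u} [Category.{v} C] [Preadditive C] [Linear R C]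
    [HomGraded R H C] [TauGraded R τ C] {D : Type*} [Category* D] [Preadditive D] [Linear R D]
    [HomGraded R H D] [TauGraded R τ D] (F : C ⥤ D) : Prop where
  additive : F.Additive
  linear : F.Linear R
  map_mem : ∀ (h : H) {X Y : C} (f : X ⟶ Y), f ∈ homDeg R h X Y →
    F.map f ∈ homDeg R h (F.obj X) (F.obj Y)
  obj_degree : ∀ (g : G) (X : C), HasDegree R τ g X → HasDegree R τ g (F.obj X)

/-- `C` and `D` are `τ`-graded equivalent: there are `τ`-graded functors `C ⥤ D` and `D ⥤ C` which
are mutually inverse up to natural isomorphisms with components of degree `1`. -/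
def TauEquivalent (C : Type u) [Category.{v} C] [Preadditive C] [Linear R C]
    [HomGraded R H C] [TauGraded R τ C] (D : Type*) [Category* D] [Preadditive D] [Linear R D]
    [HomGraded R H D] [TauGraded R τ D] : Prop :=
  ∃ e : C ≌ D, IsTauFunctor R τ e.functor ∧ IsTauFunctor R τ e.inverse ∧
    (∀ X : C, e.unit.app X ∈ homDeg R (1 : H) X (e.inverse.obj (e.functor.obj X)) ∧
      e.unitInv.app X ∈ homDeg R (1 : H) (e.inverse.obj (e.functor.obj X)) X) ∧
    (∀ Y : D, e.counit.app Y ∈ homDeg R (1 : H) (e.functor.obj (e.inverse.obj Y)) Y ∧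
      e.counitInv.app Y ∈ homDeg R (1 : H) Y (e.functor.obj (e.inverse.obj Y)))

end TauGraded

/-! ### Shifts and semisimplicity -/

section Shifts

variable (R : Type uR) [CommRing R] {H : Type uH} [Group H] {C : Type u} [Category.{v} C]
  [Preadditive C] [Linear R C] [HomGraded R H C]

/-- `Y` is a shift of `X` by `a`: there is an isomorphism `X → Y` of degree `a`. (The inverse of an
isomorphism of degree `a` has degree `a⁻¹`.) -/
def IsShift (a : H) (X Y : C) : Prop :=
  ∃ r : X ≅ Y, r.hom ∈ homDeg R a X Y ∧ r.inv ∈ homDeg R a⁻¹ Y X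

variable {R}

lemma IsShift.refl (X : C) : IsShift R (1 : H) X X :=
  ⟨Iso.refl X, id_mem X, by simpa using id_mem (R := R) (H := H) X⟩

lemma IsShift.symm {a : H} {X Y : C} (h : IsShift R a X Y) : IsShift R a⁻¹ Y X := by
  obtain ⟨r, h₁, h₂⟩ := h
  exact ⟨r.symm, h₂, by simpa using h₁⟩

lemma IsShift.trans {a b : H} {X Y Z : C} (h : IsShift R a X Y) (h' : IsShift R b Y Z) :
    IsShift R (b * a) X Z := by
  obtain ⟨r, h₁, h₂⟩ := h
  obtain ⟨s, h₃, h₄⟩ := h'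
  exact ⟨r ≪≫ s, comp_mem h₁ h₃, by simpa using comp_mem h₄ h₂⟩

variable (R)

/-- `L_S = {a | S⟨a⟩ ≅ S}`, as a subgroup of `H`; here `≅` means isomorphism in `C¹`. -/
def shiftStab (S : C) : Subgroup H where
  carrier := {a | ∃ T : C, IsShift R a S T ∧ Nonempty ((⟨T⟩ : DegOne R H C) ≅ ⟨S⟩)}
  one_mem' := ⟨S, IsShift.refl S, ⟨Iso.refl _⟩⟩
  mul_mem' := by
    rintro a b ⟨T, h, ⟨i⟩⟩ ⟨T', h', ⟨i'⟩⟩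
    have e' : IsShift R (1 : H) T' S :=
      ⟨⟨DegOne.val i'.hom, DegOne.val i'.inv, congrArg DegOne.val i'.hom_inv_id,
        congrArg DegOne.val i'.inv_hom_id⟩, DegOne.val_mem i'.hom,
        by simpa using DegOne.val_mem i'.inv⟩
    exact ⟨T, by simpa using (h'.trans e').trans h, ⟨i⟩⟩
  inv_mem' := by
    rintro a ⟨T, h, ⟨i⟩⟩
    have e : IsShift R (1 : H) T S :=
      ⟨⟨DegOne.val i.hom, DegOne.val i.inv, congrArg DegOne.val i.hom_inv_id,
        congrArg DegOne.val i.inv_hom_id⟩, DegOne.val_mem i.hom,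
        by simpa using DegOne.val_mem i.inv⟩
    exact ⟨S, by simpa using (h.trans e).symm, ⟨Iso.refl _⟩⟩

variable (H C)

/-- `C` has shifts: every object has a shift by every element of `H`. -/
def HasShifts : Prop := ∀ (X : C) (a : H), ∃ Y : C, IsShift R a X Y

/-- A `τ`-graded category is semisimple if it has shifts and `C¹` is `R`-linear semisimple. -/
def IsSemisimple : Prop := HasShifts R H C ∧ IsLinearSemisimple R (DegOne R H C)

variable {C}

/-- An object of `C` is simple if it is `R`-linear simple in `C¹`. -/
def IsSimple (S : C) : Prop := IsLinearSimple R (⟨S⟩ : DegOne R H C)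

/-- `X` and `Y` are isomorphic by an isomorphism of arbitrary degree. -/
def GenIso (X Y : C) : Prop := ∃ a : H, IsShift R a X Y

/-- `(S i)` is a representative collection of the simple objects up to general isomorphism. -/
structure IsSimpleReps {I : Type w} (S : I → C) : Prop where
  simple : ∀ i, IsSimple R H (S i)
  inj : ∀ i j, GenIso R H (S i) (S j) → i = j
  surj : ∀ T : C, IsSimple R H T → ∃ i, GenIso R H (S i) T

end Shifts

/-! ### Normalised 2-cocycles -/

/-- A normalised 2-cocycle `ψ : H² → Hom_Set(H/L, Rˣ)`, the right action of `H` on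
`Hom_Set(H/L, Rˣ)` being `(f ◁ h)(kL) = f(hkL)`. -/
structure NormCocycle (R : Type uR) [CommRing R] {H : Type uH} [Group H] (L : Subgroup H) where
  toFun : H → H → H ⧸ L → Rˣ
  cocycle : ∀ (a b c : H) (x : H ⧸ L),
    toFun b c x * (toFun (a * b) c x)⁻¹ * toFun a (b * c) x * (toFun a b (c • x))⁻¹ = 1
  one_left : ∀ (h : H) (x : H ⧸ L), toFun 1 h x = 1
  one_right : ∀ (h : H) (x : H ⧸ L), toFun h 1 x = 1

lemma NormCocycle.mul_eq {R : Type uR} [CommRing R] {H : Type uH} [Group H] {L : Subgroup H}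
    (ψ : NormCocycle R L) (a b c : H) (x : H ⧸ L) :
    ψ.toFun b c x * ψ.toFun a (b * c) x = ψ.toFun a b (c • x) * ψ.toFun (a * b) c x := by
  have h := ψ.cocycle a b c x
  rw [mul_inv_eq_one] at h
  rw [← h]
  rw [mul_right_comm, inv_mul_cancel_right]

/-- The choices which determine the cocycle `ψ_S` of an object `S`: a representative `rep x` of
every coset `x ∈ H/L_S`, a shift `shift x = S⟨rep x⟩`, and for all `a` and all cosets `x`,
`y = a x` a morphism `f a` spanning `Hom^a(S⟨rep x⟩, S⟨rep y⟩)`, where `f 1 = id`. -/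
structure ShiftFrame (R : Type uR) [CommRing R] (H : Type uH) [Group H] {C : Type u}
    [Category.{v} C] [Preadditive C] [Linear R C] [HomGraded R H C] (S : C) where
  rep : H ⧸ shiftStab R (H := H) S → H
  rep_mk : ∀ x, (QuotientGroup.mk (rep x) : H ⧸ shiftStab R (H := H) S) = x
  shift : H ⧸ shiftStab R (H := H) S → C
  isShift : ∀ x, IsShift R (rep x) S (shift x)
  f : ∀ (a : H) {x y : H ⧸ shiftStab R (H := H) S}, a • x = y → (shift x ⟶ shift y)
  span_f : ∀ (a : H) {x y : H ⧸ shiftStab R (H := H) S} (h : a • x = y),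
    Submodule.span R {f a h} = homDeg R a (shift x) (shift y)
  f_one : ∀ x, f 1 (one_smul H x) = 𝟙 (shift x)

/-- `ψ` is the cocycle `ψ_S` obtained from the choices `F`:
`f^{ab}_x = ψ(a,b)(x) • f^a_{bx} ∘ f^b_x`. -/
def ShiftFrame.IsCocycle {R : Type uR} [CommRing R] {H : Type uH} [Group H] {C : Type u}
    [Category.{v} C] [Preadditive C] [Linear R C] [HomGraded R H C] {S : C}
    (F : ShiftFrame R H S) (ψ : NormCocycle R (shiftStab R (H := H) S)) : Prop :=
  ∀ (a b : H) {x y z : H ⧸ shiftStab R (H := H) S} (hxy : b • x = y) (hyz : a • y = z)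
    (hxz : (a * b) • x = z),
    F.f (a * b) hxz = (ψ.toFun a b x : R) • (F.f b hxy ≫ F.f a hyz)

/-! ### The category `S_τ(L, ψ)⟨g⟩` -/

/-- The category `S_τ(L, ψ)⟨g⟩`; its objects `R_x` are indexed by the cosets `x ∈ H/L`. -/
@[ext]
structure SCat {H : Type uH} [Group H] {G : Type uG} [Group G] (τ : H →* G) (R : Type uR)
    [CommRing R] (L : Subgroup H) (hL : L ≤ τ.ker) (ψ : NormCocycle R L) (g : G) where
  coset : H ⧸ L

namespace SCat

variable {H : Type uH} [Group H] {G : Type uG} [Group G] {τ : H →* G} {R : Type uR}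
  [CommRing R] {L : Subgroup H} {hL : L ≤ τ.ker} {ψ : NormCocycle R L} {g : G}

/-- The degree `|R_{hL}| = τ(h) g`. -/
def deg (X : SCat τ R L hL ψ g) : G :=
  Quotient.liftOn' X.coset (fun h => τ h * g) (by
    intro a b hab
    rw [QuotientGroup.leftRel_apply] at hab
    have := hL hab
    rw [MonoidHom.mem_ker, map_mul, map_inv, inv_mul_eq_one] at this
    simp [this])

/-- Morphisms `R_x → R_y`: the free module on the symbols `e^a_x` with `a x = y`. -/
abbrev SHom (X Y : SCat τ R L hL ψ g) : Type _ := {a : H // a • X.coset = Y.coset} →₀ R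

/-- Composition (first `f`, then `f'`), bilinear with
`e^a_{bx} ∘ e^b_x = ψ(a,b)(x)⁻¹ e^{ab}_x`. -/
def compHom (X Y Z : SCat τ R L hL ψ g) : SHom X Y →ₗ[R] SHom Y Z →ₗ[R] SHom X Z :=
  Finsupp.linearCombination R fun b => Finsupp.linearCombination R fun a =>
    Finsupp.single ⟨a.1 * b.1, by rw [mul_smul, b.2, a.2]⟩ (((ψ.toFun a.1 b.1 X.coset)⁻¹ : Rˣ) : R)

lemma compHom_single {X Y Z : SCat τ R L hL ψ g} (b : {a : H // a • X.coset = Y.coset}) (r : R)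
    (a : {a : H // a • Y.coset = Z.coset}) (s : R) :
    compHom X Y Z (Finsupp.single b r) (Finsupp.single a s) =
      Finsupp.single ⟨a.1 * b.1, by rw [mul_smul, b.2, a.2]⟩
        (r * s * (((ψ.toFun a.1 b.1 X.coset)⁻¹ : Rˣ) : R)) := by
  simp only [compHom, Finsupp.linearCombination_single, LinearMap.smul_apply, Finsupp.smul_single,
    smul_eq_mul, mul_assoc]

instance : Category (SCat τ R L hL ψ g) where
  Hom X Y := SHom X Y
  id X := Finsupp.single ⟨1, one_smul _ _⟩ 1
  comp f f' := compHom _ _ _ f f'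
  id_comp {X Y} f := by
    induction f using Finsupp.induction_linear with
    | zero => simp
    | add f f' h h' => rw [map_add, h, h']
    | single a r =>
      rw [compHom_single]
      simp [ψ.one_right]
  comp_id {X Y} f := by
    induction f using Finsupp.induction_linear with
    | zero => simp
    | add f f' h h' => rw [map_add, LinearMap.add_apply, h, h']
    | single a r =>
      rw [compHom_single]
      simp [ψ.one_left]
  assoc {X Y Z W} f f' f'' := by
    induction f using Finsupp.induction_linear with
    | zero => simp
    | add p q h h' => simp only [map_add, LinearMap.add_apply, h, h']
    | single c r =>
      induction f' using Finsupp.induction_linear with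
      | zero => simp
      | add p q h h' => simp only [map_add, LinearMap.add_apply, h, h']
      | single b s =>
        induction f'' using Finsupp.induction_linear with
        | zero => simp
        | add p q h h' => simp only [map_add, h, h']
        | single a t =>
          simp only [compHom_single]
          have key := congrArg (fun u : Rˣ => ((u⁻¹ : Rˣ) : R))
            (ψ.mul_eq a.1 b.1 c.1 X.coset)
          simp only [mul_inv, Units.val_mul, c.2] at key
          congr 1
          · simp [mul_assoc]
          · linear_combination (r * s * t) * key

instance (X Y : SCat τ R L hL ψ g) : AddCommGroup (X ⟶ Y) :=
  inferInstanceAs (AddCommGroup (SHom X Y))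

instance (X Y : SCat τ R L hL ψ g) : Module R (X ⟶ Y) :=
  inferInstanceAs (Module R (SHom X Y))

lemma comp_eq {X Y Z : SCat τ R L hL ψ g} (f : X ⟶ Y) (k : Y ⟶ Z) :
    f ≫ k = compHom X Y Z f k := rfl

lemma compHom_add_left {X Y Z : SCat τ R L hL ψ g} (f f' : SHom X Y) (k : SHom Y Z) :
    compHom X Y Z (f + f') k = compHom X Y Z f k + compHom X Y Z f' k := by
  rw [map_add, LinearMap.add_apply]

lemma compHom_smul_left {X Y Z : SCat τ R L hL ψ g} (r : R) (f : SHom X Y) (k : SHom Y Z) :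
    compHom X Y Z (r • f) k = r • compHom X Y Z f k := by
  rw [map_smul, LinearMap.smul_apply]

lemma compHom_add_right {X Y Z : SCat τ R L hL ψ g} (f : SHom X Y) (k k' : SHom Y Z) :
    compHom X Y Z f (k + k') = compHom X Y Z f k + compHom X Y Z f k' := by
  rw [map_add]

lemma compHom_smul_right {X Y Z : SCat τ R L hL ψ g} (r : R) (f : SHom X Y) (k : SHom Y Z) :
    compHom X Y Z f (r • k) = r • compHom X Y Z f k := by
  rw [map_smul]

lemma add_comp' {X Y Z : SCat τ R L hL ψ g} (f f' : X ⟶ Y) (k : Y ⟶ Z) :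
    (f + f') ≫ k = f ≫ k + f' ≫ k := by
  have := compHom_add_left f f' k
  with_reducible_and_instances exact this

lemma comp_add' {X Y Z : SCat τ R L hL ψ g} (f : X ⟶ Y) (k k' : Y ⟶ Z) :
    f ≫ (k + k') = f ≫ k + f ≫ k' := by
  have := compHom_add_right f k k'
  with_reducible_and_instances exact this

lemma smul_comp' {X Y Z : SCat τ R L hL ψ g} (r : R) (f : X ⟶ Y) (k : Y ⟶ Z) :
    (r • f) ≫ k = r • (f ≫ k) := by
  have := compHom_smul_left r f k
  with_reducible_and_instances exact this

lemma comp_smul' {X Y Z : SCat τ R L hL ψ g} (f : X ⟶ Y) (r : R) (k : Y ⟶ Z) :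
    f ≫ (r • k) = r • (f ≫ k) := by
  have := compHom_smul_right r f k
  with_reducible_and_instances exact this

instance : Preadditive (SCat τ R L hL ψ g) where
  homGroup _ _ := inferInstance
  add_comp _ _ _ f f' k := add_comp' f f' k
  comp_add _ _ _ f k k' := comp_add' f k k'

instance : Linear R (SCat τ R L hL ψ g) where
  homModule _ _ := inferInstance
  smul_comp _ _ _ r f k := smul_comp' r f k
  comp_smul _ _ _ f r k := comp_smul' f r k

/-- The morphism `e^a_x : R_x → R_{ax}`. -/
def e (a : H) {X Y : SCat τ R L hL ψ g} (h : a • X.coset = Y.coset) : X ⟶ Y :=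
  (Finsupp.single ⟨a, h⟩ 1 : SHom X Y)

lemma id_eq (X : SCat τ R L hL ψ g) : 𝟙 X = e 1 (one_smul H X.coset) := rfl

lemma e_comp_e (a b : H) {X Y Z : SCat τ R L hL ψ g} (hb : b • X.coset = Y.coset)
    (ha : a • Y.coset = Z.coset) (hab : (a * b) • X.coset = Z.coset) :
    e b hb ≫ e a ha = (((ψ.toFun a b X.coset)⁻¹ : Rˣ) : R) • e (a * b) hab := by
  refine (compHom_single (⟨b, hb⟩ : {c : H // c • X.coset = Y.coset}) (1 : R)
    (⟨a, ha⟩ : {c : H // c • Y.coset = Z.coset}) 1).trans ?_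
  refine Eq.trans ?_ (Finsupp.smul_single _ _ _).symm
  simp

lemma supported_indep (X Y : SCat τ R L hL ψ g) :
    iSupIndep fun h : H => (Finsupp.supported R R {p | p.1 = h} : Submodule R (SHom X Y)) := by
  intro h
  have : (⨆ k, ⨆ (_ : k ≠ h), (Finsupp.supported R R {p | p.1 = k} : Submodule R (SHom X Y))) ≤
      Finsupp.supported R R {p | p.1 ≠ h} :=
    iSup_le fun k => iSup_le fun hk => Finsupp.supported_mono (by
      rintro p rfl
      exact hk)
  refine Disjoint.mono_right this (Finsupp.disjoint_supported_supported ?_)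
  rw [Set.disjoint_left]
  intro p hp hp'
  exact hp' hp

lemma supported_top (X Y : SCat τ R L hL ψ g) :
    ⨆ h : H, (Finsupp.supported R R {p | p.1 = h} : Submodule R (SHom X Y)) = ⊤ := by
  rw [← Finsupp.supported_iUnion, ← Finsupp.supported_univ]
  congr 1
  ext p
  simp

lemma compHom_supported {X Y Z : SCat τ R L hL ψ g} {h h' : H} {f : SHom X Y} {k : SHom Y Z}
    (hf : f ∈ (Finsupp.supported R R {p | p.1 = h} : Submodule R (SHom X Y)))
    (hk : k ∈ (Finsupp.supported R R {p | p.1 = h'} : Submodule R (SHom Y Z))) :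
    compHom X Y Z f k ∈
      (Finsupp.supported R R {p | p.1 = h' * h} : Submodule R (SHom X Z)) := by
  rw [Finsupp.supported_eq_span_single] at hf hk
  induction hf using Submodule.span_induction with
  | zero => simp
  | add x y _ _ hx hy => rw [compHom_add_left]; exact Submodule.add_mem _ hx hy
  | smul r x _ hx => rw [compHom_smul_left]; exact Submodule.smul_mem _ _ hx
  | mem x hx =>
    obtain ⟨b, rfl, rfl⟩ := hx
    induction hk using Submodule.span_induction with
    | zero => simp
    | add x y _ _ hx hy => rw [compHom_add_right]; exact Submodule.add_mem _ hx hy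
    | smul r x _ hx => rw [compHom_smul_right]; exact Submodule.smul_mem _ _ hx
    | mem y hy =>
      obtain ⟨a, rfl, rfl⟩ := hy
      simp only [compHom_single]
      exact Finsupp.single_mem_supported R _ rfl

/-- The morphisms of degree `a` are the combinations of the `e^a_x`. -/
instance : HomGraded R H (SCat τ R L hL ψ g) where
  homDeg h X Y := (Finsupp.supported R R {p | p.1 = h} : Submodule R (SHom X Y))
  indep X Y := supported_indep X Y
  iSup_eq_top X Y := supported_top X Y
  id_mem _ := Finsupp.single_mem_supported (M := R) R (1 : R) rfl
  comp_mem hf hk := compHom_supported hf hk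

lemma coset_eq {X Y : SCat τ R L hL ψ g} {h : H} (f : X ⟶ Y) (hf : f ∈ homDeg R h X Y)
    (hne : f ≠ 0) : h • X.coset = Y.coset := by
  by_contra hcon
  apply hne
  have hf' : (f : SHom X Y) ∈
      (Finsupp.supported R R {p | p.1 = h} : Submodule R (SHom X Y)) := hf
  have : ({p | p.1 = h} : Set {a : H // a • X.coset = Y.coset}) = ∅ := by
    ext p
    simp only [Set.mem_ofPred_eq, Set.mem_empty_iff_false, iff_false]
    rintro rfl
    exact hcon p.2
  rw [this, Finsupp.supported_empty] at hf'
  exact hf'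

lemma deg_smul {X Y : SCat τ R L hL ψ g} {h : H} (hXY : h • X.coset = Y.coset) :
    Y.deg = τ h * X.deg := by
  obtain ⟨x⟩ := X
  obtain ⟨y⟩ := Y
  obtain rfl : h • x = y := hXY
  induction x using QuotientGroup.induction_on with
  | H k =>
    change τ (h * k) * g = τ h * (τ k * g)
    rw [map_mul, mul_assoc]

lemma id_ne_zero [Nontrivial R] (X : SCat τ R L hL ψ g) : 𝟙 X ≠ 0 := by
  intro h
  have : (Finsupp.single ⟨1, one_smul _ _⟩ 1 : SHom X X) = 0 := h
  simp at this

lemma deg_eq_of_ne_zero {X Y : DegOne R H (SCat τ R L hL ψ g)} (f : X ⟶ Y) (hf : f ≠ 0) :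
    Y.obj.deg = X.obj.deg := by
  have := deg_smul (coset_eq (DegOne.val f) (DegOne.val_mem f)
    (fun h => hf (DegOne.hom_ext h)))
  simpa using this

/-- `|R_{hL}| = τ(h) g`. -/
instance [Nontrivial R] : TauGraded R τ (SCat τ R L hL ψ g) where
  grading :=
    { mem := fun d X => X.obj.deg = d
      closed := by
        intro d X Y i hX
        rw [← hX]
        refine deg_eq_of_ne_zero i.hom fun h => id_ne_zero X.obj ?_
        have := i.hom_inv_id
        rw [h, zero_comp] at this
        exact (congrArg DegOne.val this).symm
      zero := by
        intro d X hX
        exact absurd (congrArg DegOne.val (hX.eq_of_src (𝟙 X) 0)) (id_ne_zero X.obj)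
      disjoint := by
        intro d d' hd X Y hX hY f
        by_contra hf
        exact hd (by rw [← hX, ← hY, deg_eq_of_ne_zero f hf])
      decomp := by
        intro X
        refine ⟨{X.obj.deg}, fun _ => X, ?_, fun _ => 𝟙 X, fun _ => 𝟙 X, ?_, ?_, ?_⟩
        · rintro ⟨d, hd⟩
          exact (Finset.mem_singleton.1 hd).symm
        · intro _; simp
        · rintro ⟨j, hj⟩ ⟨k, hk⟩ hjk
          refine absurd (Subtype.ext ?_) hjk
          rw [Finset.mem_singleton] at hj hk
          exact hj.trans hk.symm
        · simp }
  homDeg_eq_bot := by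
    intro x y X Y hX hY h hne
    rw [Submodule.eq_bot_iff]
    intro f hf
    by_contra hf0
    apply hne
    rw [← hX, ← hY]
    exact deg_smul (coset_eq f hf hf0)

end SCat

/-! ### Generalities on gradings -/

lemma iSupIndep_of_entries {R : Type uR} [CommRing R] {H : Type uH} {M : Type v} [AddCommGroup M]
    [Module R M] (N : H → Submodule R M) {J : Type w} {M' : J → Type u}
    [∀ j, AddCommGroup (M' j)] [∀ j, Module R (M' j)] (N' : ∀ j, H → Submodule R (M' j))
    (ent : ∀ j, M →ₗ[R] M' j) (hent : ∀ j h m, m ∈ N h → ent j m ∈ N' j h)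
    (hinj : ∀ m, (∀ j, ent j m = 0) → m = 0) (hind : ∀ j, iSupIndep (N' j)) : iSupIndep N := by
  intro h
  rw [Submodule.disjoint_def]
  intro m hm hm'
  refine hinj m fun j => ?_
  refine Submodule.disjoint_def.1 (hind j h) _ (hent j h m hm) ?_
  have : (⨆ k, ⨆ (_ : k ≠ h), N k) ≤ (⨆ k, ⨆ (_ : k ≠ h), N' j k).comap (ent j) :=
    iSup_le fun k => iSup_le fun hk m hm =>
      (le_iSup₂ (f := fun k (_ : k ≠ h) => N' j k) k hk) (hent j k m hm)
  exact this hm'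

lemma iSup_eq_top_of_entries {R : Type uR} [CommRing R] {H : Type uH} {M : Type v}
    [AddCommGroup M] [Module R M] (N : H → Submodule R M) {J : Type w} {M' : J → Type u}
    [∀ j, AddCommGroup (M' j)] [∀ j, Module R (M' j)] (N' : ∀ j, H → Submodule R (M' j))
    (inc : ∀ j, M' j →ₗ[R] M) (hinc : ∀ j h m, m ∈ N' j h → inc j m ∈ N h)
    (hsum : ∀ m, ∃ (s : Finset J) (m' : ∀ j, M' j), m = ∑ j ∈ s, inc j (m' j))
    (htop : ∀ j, ⨆ h, N' j h = ⊤) : ⨆ h, N h = ⊤ := by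
  rw [eq_top_iff]
  rintro m -
  obtain ⟨s, m', rfl⟩ := hsum m
  refine Submodule.sum_mem _ fun j _ => ?_
  have : (⨆ h, N' j h) ≤ (⨆ h, N h).comap (inc j) :=
    iSup_le fun h m hm => (le_iSup N h) (hinc j h m hm)
  exact this (by rw [htop]; trivial)

lemma ObjGrading.mem_iff {G : Type uG} {D : Type u} [Category.{v} D] [Preadditive D]
    (Γ : ObjGrading G D) {g : G} {X : D} :
    Γ.mem g X ↔ ∀ g' : G, g ≠ g' → ∀ Y : D, Γ.mem g' Y → ∀ f : X ⟶ Y, f = 0 := by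
  refine ⟨fun hX g' hg Y hY f => Γ.disjoint hg hX hY f, fun hX => ?_⟩
  classical
  obtain ⟨s, Y, hY, ι, π, h₁, -, h₃⟩ := Γ.decomp X
  by_cases hg : g ∈ s
  · rw [Finset.sum_eq_single ⟨g, hg⟩
      (fun k _ hk => by
        rw [hX k.1 (fun h => hk (Subtype.ext h.symm)) (Y k) (hY k) (π k), zero_comp])
      (fun h => absurd (Finset.mem_univ _) h)] at h₃
    exact Γ.closed (Iso.symm ⟨π ⟨g, hg⟩, ι ⟨g, hg⟩, h₃, h₁ _⟩) (hY ⟨g, hg⟩)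
  · refine Γ.zero g ((IsZero.iff_id_eq_zero X).2 ?_)
    rw [← h₃]
    refine Finset.sum_eq_zero fun k _ => ?_
    rw [hX k.1 (fun h => hg (h ▸ k.2)) (Y k) (hY k) (π k), zero_comp]

lemma ObjGrading.exists_total {G : Type uG} {D : Type u} [Category.{v} D] [Preadditive D]
    [HasZeroObject D] (Γ : ObjGrading G D) (X : D) :
    ∃ (s : Finset G) (Y : G → D) (ι : ∀ g, Y g ⟶ X) (π : ∀ g, X ⟶ Y g),
      (∀ g, Γ.mem g (Y g)) ∧ (∀ g, ι g ≫ π g = 𝟙 (Y g)) ∧ (∑ g ∈ s, π g ≫ ι g = 𝟙 X) ∧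
      ∀ g, g ∉ s → IsZero (Y g) := by
  obtain ⟨s, Y, hY, ι, π, h₁, -, h₃⟩ := Γ.decomp X
  have key : ∀ g : G, ∃ (Z : D) (i : Z ⟶ X) (p : X ⟶ Z), Γ.mem g Z ∧ i ≫ p = 𝟙 Z ∧
      (∀ h : g ∈ s, p ≫ i = π ⟨g, h⟩ ≫ ι ⟨g, h⟩) ∧ (g ∉ s → IsZero Z) := by
    intro g
    by_cases hg : g ∈ s
    · exact ⟨Y ⟨g, hg⟩, ι ⟨g, hg⟩, π ⟨g, hg⟩, hY ⟨g, hg⟩, h₁ ⟨g, hg⟩, fun _ => rfl, fun h => absurd hg h⟩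
    · obtain ⟨Z, hZ⟩ := HasZeroObject.zero (C := D)
      exact ⟨Z, 0, 0, Γ.zero g hZ, hZ.eq_of_src _ _, fun h => absurd h hg, fun _ => hZ⟩
  choose Z i p hm hid hpi hz using key
  refine ⟨s, Z, i, p, hm, hid, ?_, hz⟩
  rw [← h₃, ← Finset.sum_coe_sort]
  exact Finset.sum_congr rfl fun g _ => hpi g.1 g.2

/-! ### Completion under finite direct sums -/

namespace MatGrading

variable {R : Type uR} [CommRing R] {H : Type uH} [Group H] {G : Type uG} [Group G]
  {τ : H →* G} {C : Type u} [Category.{v} C] [Preadditive C] [Linear R C]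

instance (M N : Mat_ C) : Module R (M ⟶ N) :=
  inferInstanceAs (Module R (∀ (i : M.ι) (j : N.ι), M.X i ⟶ N.X j))

@[simp] lemma smul_apply {M N : Mat_ C} (r : R) (f : M ⟶ N) (i : M.ι) (j : N.ι) :
    (r • f) i j = r • f i j := rfl

instance : Linear R (Mat_ C) where
  homModule _ _ := inferInstance
  smul_comp M N K r f k := by
    ext i j
    simp [Finset.smul_sum]
  comp_smul M N K f r k := by
    ext i j
    simp [Finset.smul_sum]

variable (R) in
/-- The `(i, j)` entry of a matrix. -/
def ent {M N : Mat_ C} (p : M.ι × N.ι) : (M ⟶ N) →ₗ[R] (M.X p.1 ⟶ N.X p.2) where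
  toFun f := f p.1 p.2
  map_add' _ _ := rfl
  map_smul' _ _ := rfl

open scoped Classical in
/-- The matrix with a single nonzero entry. -/
def incFun {M N : Mat_ C} (p : M.ι × N.ι) (f : M.X p.1 ⟶ N.X p.2) : M ⟶ N :=
  fun i j => if h : p = (i, j) then eqToHom (by rw [h]) ≫ f ≫ eqToHom (by rw [h]) else 0

lemma incFun_self {M N : Mat_ C} (i : M.ι) (j : N.ι) (f : M.X i ⟶ N.X j) :
    incFun (M := M) (N := N) (i, j) f i j = f := by
  simp [incFun]

lemma incFun_ne {M N : Mat_ C} (p : M.ι × N.ι) (f : M.X p.1 ⟶ N.X p.2) (i : M.ι) (j : N.ι)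
    (h : p ≠ (i, j)) : incFun (M := M) (N := N) p f i j = 0 := by
  simp [incFun, h]

variable (R) in
/-- `incFun` as a linear map. -/
def inc {M N : Mat_ C} (p : M.ι × N.ι) : (M.X p.1 ⟶ N.X p.2) →ₗ[R] (M ⟶ N) where
  toFun f := incFun p f
  map_add' f f' := by
    ext i j
    rw [Mat_.add_apply]
    by_cases h : p = (i, j)
    · subst h; simp only [incFun_self]
    · simp only [incFun_ne _ _ _ _ h, add_zero]
  map_smul' r f := by
    ext i j
    rw [smul_apply]
    by_cases h : p = (i, j)
    · subst h; simp only [incFun_self, RingHom.id_apply]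
    · simp only [incFun_ne _ _ _ _ h, smul_zero]

lemma sum_apply {M N : Mat_ C} {J : Type*} (s : Finset J) (f : J → (M ⟶ N)) (i : M.ι)
    (j : N.ι) : (∑ k ∈ s, f k) i j = ∑ k ∈ s, f k i j :=
  map_sum (ent ℤ (M := M) (N := N) (i, j)) f s

lemma eq_sum_inc {M N : Mat_ C} (f : M ⟶ N) :
    f = ∑ p : M.ι × N.ι, inc R p (f p.1 p.2) := by
  classical
  ext i j
  rw [sum_apply, Finset.sum_eq_single (i, j)]
  · exact (incFun_self i j (f i j)).symm
  · intro p _ hp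
    exact incFun_ne p _ i j hp
  · intro h
    exact absurd (Finset.mem_univ _) h

variable [HomGraded R H C]

/-- The matrices all of whose entries have degree `h`. -/
def matDeg (h : H) (M N : Mat_ C) : Submodule R (M ⟶ N) where
  carrier := {f | ∀ i j, f i j ∈ homDeg R h (M.X i) (N.X j)}
  add_mem' hf hf' i j := Submodule.add_mem _ (hf i j) (hf' i j)
  zero_mem' _ _ := Submodule.zero_mem _
  smul_mem' r _ hf i j := Submodule.smul_mem _ r (hf i j)

/-- A matrix is homogeneous of degree `h` if all its entries are. -/
instance : HomGraded R H (Mat_ C) where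
  homDeg h M N := matDeg h M N
  indep M N := iSupIndep_of_entries (fun h => matDeg h M N)
    (fun (p : M.ι × N.ι) h => homDeg R h (M.X p.1) (N.X p.2)) (fun p => ent R p)
    (fun p _ _ hm => hm p.1 p.2)
    (fun m hm => by
      ext i j
      exact hm (i, j)) (fun _ => HomGraded.indep _ _)
  iSup_eq_top M N := iSup_eq_top_of_entries (fun h => matDeg h M N)
    (fun (p : M.ι × N.ι) h => homDeg R h (M.X p.1) (N.X p.2)) (fun p => inc R p)
    (by
      intro p h m hm i j
      change incFun p m i j ∈ _
      by_cases hp : p = (i, j)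
      · subst hp
        rw [incFun_self]
        exact hm
      · rw [incFun_ne _ _ _ _ hp]
        exact Submodule.zero_mem _)
    (fun m => ⟨Finset.univ, fun p => m p.1 p.2, eq_sum_inc m⟩)
    (fun _ => HomGraded.iSup_eq_top _ _)
  id_mem M := by
    intro i j
    by_cases h : i = j
    · subst h
      rw [Mat_.id_apply_self]
      exact id_mem _
    · rw [Mat_.id_apply_of_ne _ _ _ h]
      exact Submodule.zero_mem _
  comp_mem hf hk := fun i j => Submodule.sum_mem _ fun k _ => comp_mem (hf i k) (hk k j)

lemma mem_homDeg_iff {M N : Mat_ C} (h : H) (f : M ⟶ N) :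
    f ∈ homDeg R h M N ↔ ∀ i j, f i j ∈ homDeg R h (M.X i) (N.X j) := Iff.rfl

/-- The degree `1` part of a matrix entry. -/
def entry {M N : DegOne R H (Mat_ C)} (f : M ⟶ N) (i : M.obj.ι) (j : N.obj.ι) :
    (⟨M.obj.X i⟩ : DegOne R H C) ⟶ ⟨N.obj.X j⟩ :=
  DegOne.mk' (DegOne.val f i j) (DegOne.val_mem f i j)

lemma entry_ext {M N : DegOne R H (Mat_ C)} {f f' : M ⟶ N} (h : ∀ i j, entry f i j = entry f' i j) :
    f = f' := by
  apply DegOne.hom_ext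
  ext i j
  exact congrArg DegOne.val (h i j)

lemma entry_comp {M N K : DegOne R H (Mat_ C)} (f : M ⟶ N) (f' : N ⟶ K) (i : M.obj.ι)
    (j : K.obj.ι) : entry (f ≫ f') i j = ∑ k, entry f i k ≫ entry f' k j := by
  apply DegOne.hom_ext
  rw [DegOne.val_sum]
  rfl

lemma entry_id_self (M : DegOne R H (Mat_ C)) (i : M.obj.ι) : entry (𝟙 M) i i = 𝟙 _ :=
  DegOne.hom_ext (Mat_.id_apply_self M.obj i)

lemma entry_id_ne (M : DegOne R H (Mat_ C)) {i j : M.obj.ι} (h : i ≠ j) :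
    entry (𝟙 M) i j = 0 :=
  DegOne.hom_ext (Mat_.id_apply_of_ne M.obj i j h)

lemma entry_zero (M N : DegOne R H (Mat_ C)) (i : M.obj.ι) (j : N.obj.ι) :
    entry (0 : M ⟶ N) i j = 0 := rfl

lemma entry_sum {M N : DegOne R H (Mat_ C)} {J : Type*} (s : Finset J) (f : J → (M ⟶ N))
    (i : M.obj.ι) (j : N.obj.ι) : entry (∑ k ∈ s, f k) i j = ∑ k ∈ s, entry (f k) i j := by
  apply DegOne.hom_ext
  rw [DegOne.val_sum]
  change (DegOne.val (∑ k ∈ s, f k)) i j = _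
  rw [DegOne.val_sum, sum_apply]
  rfl

/-- A matrix of morphisms of degree `1`. -/
def ofEntries {M N : DegOne R H (Mat_ C)}
    (f : ∀ i j, (⟨M.obj.X i⟩ : DegOne R H C) ⟶ ⟨N.obj.X j⟩) : M ⟶ N :=
  DegOne.mk' (show M.obj ⟶ N.obj from fun i j => DegOne.val (f i j))
    (fun i j => DegOne.val_mem (f i j))

lemma entry_ofEntries {M N : DegOne R H (Mat_ C)}
    (f : ∀ i j, (⟨M.obj.X i⟩ : DegOne R H C) ⟶ ⟨N.obj.X j⟩) (i : M.obj.ι) (j : N.obj.ι) :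
    entry (ofEntries f) i j = f i j := rfl

lemma matDecomp (Γ : ObjGrading G (DegOne R H C)) (M : DegOne R H (Mat_ C)) :
    ∃ (s : Finset G) (Y : s → DegOne R H (Mat_ C)),
      (∀ (g : s) i, Γ.mem g.1 ⟨(Y g).obj.X i⟩) ∧ IsDirectSum Y M := by
  classical
  choose s Y hY ι π h₁ h₂ h₃ using fun i : M.obj.ι => Γ.decomp ⟨M.obj.X i⟩
  let Z : ↥(Finset.univ.biUnion s) → DegOne R H (Mat_ C) := fun g =>
    ⟨{ ι := {i : M.obj.ι // g.1 ∈ s i}, X := fun i => (Y i.1 ⟨g.1, i.2⟩).obj }⟩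
  let I : ∀ g, Z g ⟶ M := fun g => ofEntries fun i j =>
    if h : i.1 = j then ι i.1 ⟨g.1, i.2⟩ ≫ eqToHom (by rw [h]) else 0
  let P : ∀ g, M ⟶ Z g := fun g => ofEntries fun j i =>
    if h : i.1 = j then eqToHom (by rw [h]) ≫ π i.1 ⟨g.1, i.2⟩ else 0
  have hI : ∀ g i, entry (I g) i i.1 = ι i.1 ⟨g.1, i.2⟩ := fun g i => by
    simp [I, entry_ofEntries]
  have hI' : ∀ g i j, i.1 ≠ j → entry (I g) i j = 0 := fun g i j h => by
    simp [I, entry_ofEntries, h]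
  have hP : ∀ g i, entry (P g) i.1 i = π i.1 ⟨g.1, i.2⟩ := fun g i => by
    simp [P, entry_ofEntries]
  have hP' : ∀ g i j, i.1 ≠ j → entry (P g) j i = 0 := fun g i j h => by
    simp [P, entry_ofEntries, h]
  have hZ : ∀ g i, Γ.mem g.1 ⟨(Z g).obj.X i⟩ := fun g i => hY i.1 ⟨g.1, i.2⟩
  refine ⟨_, Z, hZ, I, P, ?_, ?_, ?_⟩
  · intro g
    apply entry_ext
    intro i j
    rw [entry_comp, Finset.sum_eq_single i.1 (fun k _ hk => by rw [hI' g i k hk.symm, zero_comp])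
      (fun h => absurd (Finset.mem_univ _) h), hI]
    by_cases hij : i = j
    · subst hij
      rw [hP, entry_id_self]
      exact h₁ i.1 ⟨g.1, i.2⟩
    · rw [hP' g j i.1 (fun h => hij (Subtype.ext h.symm)), comp_zero, entry_id_ne _ hij]
  · intro g k hgk
    apply entry_ext
    intro i j
    exact Γ.disjoint (fun h => hgk (Subtype.ext h)) (hZ g i) (hZ k j) _
  · apply entry_ext
    intro i j
    rw [entry_sum]
    by_cases hij : i = j
    · subst hij
      rw [entry_id_self, ← h₃ i]
      have hsub : s i ⊆ Finset.univ.biUnion s := Finset.subset_biUnion_of_mem s (Finset.mem_univ i)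
      have hg : ∀ g : ↥(Finset.univ.biUnion s), entry (P g ≫ I g) i i =
          if h : g.1 ∈ s i then π i ⟨g.1, h⟩ ≫ ι i ⟨g.1, h⟩ else 0 := by
        intro g
        rw [entry_comp]
        split_ifs with h
        · rw [Finset.sum_eq_single (⟨i, h⟩ : {i : M.obj.ι // g.1 ∈ s i})
            (fun k _ hk => by
              rw [hP' g k i (fun h' => hk (Subtype.ext h')), zero_comp])
            (fun h => absurd (Finset.mem_univ _) h)]
          rw [hP g ⟨i, h⟩, hI g ⟨i, h⟩]
        · refine Finset.sum_eq_zero fun k _ => ?_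
          rw [hP' g k i (fun h' => h (h' ▸ k.2)), zero_comp]
      rw [Finset.sum_congr rfl fun g _ => hg g]
      rw [Finset.sum_coe_sort (Finset.univ.biUnion s)
        (fun g => if h : g ∈ s i then π i ⟨g, h⟩ ≫ ι i ⟨g, h⟩ else 0)]
      rw [← Finset.sum_subset hsub (fun g _ hg => dif_neg hg), ← Finset.sum_coe_sort]
      exact Finset.sum_congr rfl fun g _ => dif_pos g.2
    · rw [entry_id_ne _ hij]
      refine Finset.sum_eq_zero fun g _ => ?_
      rw [entry_comp]
      refine Finset.sum_eq_zero fun k _ => ?_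
      by_cases hk : k.1 = i
      · rw [hI' g k j (fun h => hij (hk.symm.trans h)), comp_zero]
      · rw [hP' g k i hk, zero_comp]

/-- A formal finite direct sum is homogeneous of degree `g` if all its summands are. -/
instance [TauGraded R τ C] : TauGraded R τ (Mat_ C) where
  grading :=
    { mem := fun g M => ∀ i, HasDegree R τ g (M.obj.X i)
      closed := by
        intro g M N e hM j
        refine (ObjGrading.mem_iff _).2 fun g' hg Y hY f => ?_
        have h := congrArg (fun k => entry k j j) e.inv_hom_id
        simp only [entry_comp, entry_id_self] at h
        rw [← Category.id_comp f, ← h, Preadditive.sum_comp]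
        refine Finset.sum_eq_zero fun k _ => ?_
        rw [Category.assoc]
        rw [(TauGraded.grading (R := R) (τ := τ) (C := C)).disjoint hg (hM k) hY
          (entry e.hom k j ≫ f), comp_zero]
      zero := by
        intro g M hM i
        refine ObjGrading.zero _ g ((IsZero.iff_id_eq_zero _).2 ?_)
        rw [← entry_id_self M i, (IsZero.iff_id_eq_zero _).1 hM, entry_zero]
      disjoint := by
        intro g g' hg M N hM hN f
        apply entry_ext
        intro i j
        exact ObjGrading.disjoint _ hg (hM i) (hN j) _
      decomp := matDecomp _ }
  homDeg_eq_bot := by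
    intro x y M N hM hN h hne
    rw [Submodule.eq_bot_iff]
    intro f hf
    ext i j
    have := hf i j
    rw [TauGraded.homDeg_eq_bot (τ := τ) (hM i) (hN j) h hne] at this
    exact this

end MatGrading

/-! ### Direct sums of additive `τ`-graded categories -/

/-- The direct sum `⊞ C i` of additive categories: the objects are the families `(X i)` with only
finitely many nonzero members. -/
structure BoxSum {I : Type w} (C : I → Type u) [∀ i, Category.{v} (C i)] where
  obj : ∀ i, C i
  finite : {i | ¬ IsZero (obj i)}.Finite

namespace BoxSum

variable {R : Type uR} [CommRing R] {H : Type uH} [Group H] {G : Type uG} [Group G]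
  {τ : H →* G} {I : Type w} {C : I → Type u} [∀ i, Category.{v} (C i)]
  [∀ i, Preadditive (C i)] [∀ i, Linear R (C i)]

/-- Morphisms are families of morphisms (automatically with only finitely many nonzero
members). -/
instance : Category (BoxSum C) where
  Hom X Y := ∀ i, X.obj i ⟶ Y.obj i
  id X i := 𝟙 (X.obj i)
  comp f g i := f i ≫ g i

instance (X Y : BoxSum C) : AddCommGroup (X ⟶ Y) :=
  inferInstanceAs (AddCommGroup (∀ i, X.obj i ⟶ Y.obj i))

instance (X Y : BoxSum C) : Module R (X ⟶ Y) :=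
  inferInstanceAs (Module R (∀ i, X.obj i ⟶ Y.obj i))

lemma hom_ext {X Y : BoxSum C} {f g : X ⟶ Y} (h : ∀ i, f i = g i) : f = g := funext h

instance : Preadditive (BoxSum C) where
  homGroup _ _ := inferInstance
  add_comp _ _ _ f f' k := hom_ext fun i => Preadditive.add_comp _ _ _ (f i) (f' i) (k i)
  comp_add _ _ _ f k k' := hom_ext fun i => Preadditive.comp_add _ _ _ (f i) (k i) (k' i)

instance : Linear R (BoxSum C) where
  homModule _ _ := inferInstance
  smul_comp _ _ _ r f k := hom_ext fun i => Linear.smul_comp _ _ _ r (f i) (k i)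
  comp_smul _ _ _ f r k := hom_ext fun i => Linear.comp_smul _ _ _ (f i) r (k i)

variable (R) in
/-- The `i`-th component of a morphism. -/
def comp {X Y : BoxSum C} (i : I) : (X ⟶ Y) →ₗ[R] (X.obj i ⟶ Y.obj i) where
  toFun f := f i
  map_add' _ _ := rfl
  map_smul' _ _ := rfl

open scoped Classical in
variable (R) in
/-- The morphism with a single nonzero component. -/
def inc {X Y : BoxSum C} (i : I) : (X.obj i ⟶ Y.obj i) →ₗ[R] (X ⟶ Y) :=
  LinearMap.single R (fun i => X.obj i ⟶ Y.obj i) i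

lemma inc_same {X Y : BoxSum C} (i : I) (f : X.obj i ⟶ Y.obj i) :
    inc R (X := X) (Y := Y) i f i = f := by
  classical
  exact Pi.single_eq_same (M := fun i => X.obj i ⟶ Y.obj i) i f

lemma inc_ne {X Y : BoxSum C} {i j : I} (h : j ≠ i) (f : X.obj i ⟶ Y.obj i) :
    inc R (X := X) (Y := Y) i f j = 0 := by
  classical
  exact Pi.single_eq_of_ne (M := fun i => X.obj i ⟶ Y.obj i) h f

lemma sum_apply {X Y : BoxSum C} {J : Type*} (s : Finset J) (f : J → (X ⟶ Y)) (i : I) :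
    (∑ k ∈ s, f k) i = ∑ k ∈ s, f k i :=
  map_sum (comp ℤ (X := X) (Y := Y) i) f s

lemma eq_sum_inc {X Y : BoxSum C} (f : X ⟶ Y) :
    f = ∑ i ∈ X.finite.toFinset, inc R i (f i) := by
  classical
  refine hom_ext fun i => ?_
  rw [sum_apply]
  by_cases hi : IsZero (X.obj i)
  · exact hi.eq_of_src _ _
  · rw [Finset.sum_eq_single i]
    · exact (inc_same i (f i)).symm
    · intro k _ hk
      exact inc_ne hk.symm _
    · intro h
      exact absurd (X.finite.mem_toFinset.2 hi) h

variable [∀ i, HomGraded R H (C i)]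

/-- The families all of whose members have degree `h`. -/
def boxDeg (h : H) (X Y : BoxSum C) : Submodule R (X ⟶ Y) where
  carrier := {f | ∀ i, f i ∈ homDeg R h (X.obj i) (Y.obj i)}
  add_mem' hf hf' i := Submodule.add_mem _ (hf i) (hf' i)
  zero_mem' _ := Submodule.zero_mem _
  smul_mem' r _ hf i := Submodule.smul_mem _ r (hf i)

/-- A family of morphisms is homogeneous of degree `h` if all its members are. -/
instance : HomGraded R H (BoxSum C) where
  homDeg h X Y := boxDeg h X Y
  indep X Y := iSupIndep_of_entries (fun h => boxDeg h X Y)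
    (fun i h => homDeg R h (X.obj i) (Y.obj i)) (fun i => comp R i)
    (fun i _ _ hm => hm i) (fun _ hm => hom_ext hm) (fun _ => HomGraded.indep _ _)
  iSup_eq_top X Y := iSup_eq_top_of_entries (fun h => boxDeg h X Y)
    (fun i h => homDeg R h (X.obj i) (Y.obj i)) (fun i => inc R i)
    (by
      intro i h m hm j
      by_cases hij : j = i
      · subst hij
        rw [inc_same]
        exact hm
      · rw [inc_ne hij]
        exact Submodule.zero_mem _)
    (fun m => ⟨X.finite.toFinset, fun i => m i, eq_sum_inc m⟩)
    (fun _ => HomGraded.iSup_eq_top _ _)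
  id_mem X := fun i => id_mem (X.obj i)
  comp_mem hf hk := fun i => comp_mem (hf i) (hk i)

/-- The components of an object. -/
def objAt (X : DegOne R H (BoxSum C)) (i : I) : DegOne R H (C i) := ⟨X.obj.obj i⟩

/-- The components of a morphism of degree `1`. -/
def homAt {X Y : DegOne R H (BoxSum C)} (f : X ⟶ Y) (i : I) : objAt X i ⟶ objAt Y i :=
  DegOne.mk' (DegOne.val f i) (DegOne.val_mem f i)

/-- The morphism of degree `1` with given components. -/
def ofHomAt {X Y : DegOne R H (BoxSum C)} (f : ∀ i, objAt X i ⟶ objAt Y i) : X ⟶ Y :=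
  DegOne.mk' (show X.obj ⟶ Y.obj from fun i => DegOne.val (f i)) (fun i => DegOne.val_mem (f i))

lemma homAt_ext {X Y : DegOne R H (BoxSum C)} {f g : X ⟶ Y} (h : ∀ i, homAt f i = homAt g i) :
    f = g :=
  DegOne.hom_ext (hom_ext fun i => congrArg DegOne.val (h i))

lemma homAt_sum {X Y : DegOne R H (BoxSum C)} {J : Type*} (s : Finset J) (f : J → (X ⟶ Y))
    (i : I) : homAt (∑ k ∈ s, f k) i = ∑ k ∈ s, homAt (f k) i := by
  apply DegOne.hom_ext
  rw [DegOne.val_sum]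
  change (DegOne.val (∑ k ∈ s, f k)) i = _
  rw [DegOne.val_sum, sum_apply]
  rfl

lemma isZero_degOne {D : Type u} [Category.{v} D] [Preadditive D] [Linear R D]
    [HomGraded R H D] {X : DegOne R H D} : IsZero X ↔ IsZero X.obj := by
  rw [IsZero.iff_id_eq_zero, IsZero.iff_id_eq_zero]
  exact ⟨fun h => congrArg DegOne.val h, fun h => DegOne.hom_ext h⟩

lemma boxDecomp [∀ i, HasZeroObject (C i)] (Γ : ∀ i, ObjGrading G (DegOne R H (C i)))
    (X : DegOne R H (BoxSum C)) :
    ∃ (s : Finset G) (Y : s → DegOne R H (BoxSum C)),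
      (∀ (g : s) i, (Γ i).mem g.1 (objAt (Y g) i)) ∧ IsDirectSum Y X := by
  classical
  have : ∀ i, HasZeroObject (DegOne R H (C i)) := fun i => by
    obtain ⟨Z, hZ⟩ := HasZeroObject.zero (C := C i)
    exact ⟨⟨Z⟩, isZero_degOne.2 hZ⟩
  choose s Y ι π h₀ h₁ h₃ h₄ using fun i : I => (Γ i).exists_total (objAt X i)
  have hz : ∀ i g, IsZero (objAt X i) → IsZero (Y i g) := fun i g h => by
    rw [IsZero.iff_id_eq_zero, ← h₁ i g, h.eq_of_tgt (ι i g) 0, zero_comp]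
  let Z : ↥(X.obj.finite.toFinset.biUnion s) → DegOne R H (BoxSum C) := fun g =>
    ⟨{ obj := fun i => (Y i g.1).obj
       finite := X.obj.finite.subset fun i hi h =>
        hi (isZero_degOne.1 (hz i g.1 (isZero_degOne.2 h))) }⟩
  let A : ∀ g, Z g ⟶ X := fun g => ofHomAt fun i => ι i g.1
  let P : ∀ g, X ⟶ Z g := fun g => ofHomAt fun i => π i g.1
  refine ⟨_, Z, fun g i => h₀ i g.1, A, P, ?_, ?_, ?_⟩
  · exact fun g => homAt_ext fun i => h₁ i g.1
  · exact fun g k hgk => homAt_ext fun i =>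
      (Γ i).disjoint (fun h => hgk (Subtype.ext h)) (h₀ i g.1) (h₀ i k.1) _
  · refine homAt_ext fun i => ?_
    rw [homAt_sum]
    change ∑ g : ↥(X.obj.finite.toFinset.biUnion s), π i g.1 ≫ ι i g.1 = 𝟙 (objAt X i)
    by_cases hi : IsZero (X.obj.obj i)
    · exact (isZero_degOne.2 hi : IsZero (objAt X i)).eq_of_src _ _
    · have hsub : s i ⊆ X.obj.finite.toFinset.biUnion s :=
        Finset.subset_biUnion_of_mem s (X.obj.finite.mem_toFinset.2 hi)
      rw [Finset.sum_coe_sort (X.obj.finite.toFinset.biUnion s) (fun g => π i g ≫ ι i g),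
        ← Finset.sum_subset hsub (fun g _ hg => (h₄ i g hg).eq_zero_of_src (ι i g) ▸ comp_zero)]
      exact h₃ i

/-- A family of objects is homogeneous of degree `g` if all its members are. -/
instance [∀ i, HasZeroObject (C i)] [∀ i, TauGraded R τ (C i)] : TauGraded R τ (BoxSum C) where
  grading :=
    { mem := fun g X => ∀ i, HasDegree R τ g (X.obj.obj i)
      closed := by
        intro g X Y e hX i
        refine ObjGrading.closed _ (X := objAt X i) (Y := objAt Y i)
          ⟨homAt e.hom i, homAt e.inv i, ?_, ?_⟩ (hX i)
        · exact congrArg (fun k => homAt k i) e.hom_inv_id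
        · exact congrArg (fun k => homAt k i) e.inv_hom_id
      zero := by
        intro g X hX i
        refine ObjGrading.zero _ g ((IsZero.iff_id_eq_zero (objAt X i)).2 ?_)
        exact congrArg (fun k => homAt k i) ((IsZero.iff_id_eq_zero X).1 hX)
      disjoint := by
        intro g g' hg X Y hX hY f
        exact homAt_ext fun i => ObjGrading.disjoint _ hg (hX i) (hY i) _
      decomp := boxDecomp fun i => TauGraded.grading (R := R) (τ := τ) (C := C i) }
  homDeg_eq_bot := by
    intro x y X Y hX hY h hne
    rw [Submodule.eq_bot_iff]
    intro f hf
    refine hom_ext fun i => ?_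
    have := hf i
    rw [TauGraded.homDeg_eq_bot (τ := τ) (hX i) (hY i) h hne] at this
    exact this

end BoxSum

/-- The category `M_τ(L, ψ)⟨g⟩`: the completion of `S_τ(L, ψ)⟨g⟩` under finite direct sums, whose
objects are formal finite direct sums and whose morphisms are matrices. -/
abbrev MTau {H : Type uH} [Group H] {G : Type uG} [Group G] (τ : H →* G) (R : Type uR)
    [CommRing R] (L : Subgroup H) (hL : L ≤ τ.ker) (ψ : NormCocycle R L) (g : G) : Type _ :=
  Mat_ (SCat τ R L hL ψ g)

end

end TauGrad

open TauGrad

namespace TauGrad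

noncomputable section

/-! A category all of whose objects are finite direct sums of objects from mutually disjoint full
subcategories `K i` is determined by the `K i`, because morphisms between direct sums are matrices.
This is the content of `IsGenerating` and `IsGenerating.tauEquivalent`. The classification therefore
amounts to finding the same generating subcategories, namely the categories `S_τ(L, ψ)⟨g⟩`, on both
sides. In the direct sum of their completions they are present by construction
(`isGenerating_boxSum`); in a semisimple `C` they are spanned by the shifts of the simple objects
(`IsSimpleReps.isGenerating`).

For a simple `S`, the shifts of `S` up to isomorphism of degree 1 form the `H`-set `H/L_S`
(`isShift_iff_smul_eq`). Between two of them, `Hom^a` is free of rank one if `a` carries the first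
coset to the second, and zero otherwise: a nonzero morphism of degree `a` between simple objects
makes the target a shift by `a` of the source (`IsSemisimple.isShift_of_ne_zero`). Choosing
generators `f^a_x`, the morphisms `f^{ab}_x` and `f^a_{bx} ∘ f^b_x` are both isomorphisms, so they
differ by a unit `ψ(a,b)(x)`. Associativity is the cocycle identity and `f^1 = id` is the
normalisation (`ShiftFrame.existsUnique_isCocycle`). Sending `e^a_x` to `f^a_x` is then a fully
faithful functor.

Since `R` need not be a field, or even connected, a nonzero map between simple objects need not be
invertible, and an idempotent scalar need not be 0 or 1. Schur's lemma is replaced by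
`IsLinearSimple.retract`: every retract is itself a direct sum of simple objects, and one such
summand forces the idempotent to be the identity. It follows that a simple object is isomorphic to
one of the terms in any direct sum decomposition, in particular to one of its homogeneous
components, so it has a degree. Comparing degrees along a shift of `S` onto itself gives `L_S ≤ ker
τ`.

Conversely, the objects `R_x` are simple, mutually disjoint in degree 1 and closed under shifts, and
these properties pass to finite direct sums (`IsGenerating.isSemisimple`). -/

/-- Split `m` into its part of degree `h` and a rest of other degrees. The image of the rest lies
both in `N' h` and in the span of the other `N' k`, so it vanishes, and injectivity kills the rest.
This lets faithful graded functors reflect degrees. -/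
lemma mem_of_map_mem_of_iSupIndep {R : Type*} [CommRing R] {H M M' : Type*} [AddCommGroup M]
    [Module R M] [AddCommGroup M'] [Module R M'] {N : H → Submodule R M} {N' : H → Submodule R M'}
    (φ : M →ₗ[R] M') (hφ : Function.Injective φ) (hN : ⨆ h, N h = ⊤) (hN' : iSupIndep N')
    (hmap : ∀ h, ∀ m ∈ N h, φ m ∈ N' h) {h : H} {m : M} (hm : φ m ∈ N' h) : m ∈ N h := by
  have hle : (⊤ : Submodule R M) ≤ N h ⊔ ⨆ (k) (_ : k ≠ h), N k := by
    rw [← hN]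
    refine iSup_le fun k => ?_
    by_cases hk : k = h
    · subst hk; exact le_sup_left
    · exact (le_iSup₂ (f := fun k (_ : k ≠ h) => N k) k hk).trans le_sup_right
  obtain ⟨a, ha, b, hb, rfl⟩ := Submodule.mem_sup.1 (hle (Submodule.mem_top (x := m)))
  have hb' : φ b ∈ ⨆ (k) (_ : k ≠ h), N' k := by
    have : (⨆ (k) (_ : k ≠ h), N k) ≤ (⨆ (k) (_ : k ≠ h), N' k).comap φ :=
      iSup_le fun k => iSup_le fun hk x hx =>
        (le_iSup₂ (f := fun k (_ : k ≠ h) => N' k) k hk) (hmap k x hx)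
    exact this hb
  have hb₀ : φ b = 0 := by
    refine Submodule.disjoint_def.1 (hN' h) _ ?_ hb'
    rw [map_add] at hm
    simpa using Submodule.sub_mem _ hm (hmap h a ha)
  rw [hφ (hb₀.trans (map_zero φ).symm), add_zero]
  exact ha

/-! ### Direct sum decompositions by morphisms of degree 1 -/

section Basics

variable {R : Type uR} [CommRing R] {H : Type uH} [Group H] {C : Type*} [Category* C]
  [Preadditive C] [Linear R C] [HomGraded R H C]

lemma isShift_one_of_iso {X Y : C} (e : (⟨X⟩ : DegOne R H C) ≅ ⟨Y⟩) : IsShift R (1 : H) X Y :=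
  ⟨⟨DegOne.val e.hom, DegOne.val e.inv, congrArg DegOne.val e.hom_inv_id,
    congrArg DegOne.val e.inv_hom_id⟩, DegOne.val_mem e.hom, by simpa using DegOne.val_mem e.inv⟩

lemma eqToHom_mem_homDeg {X Y : C} (h : X = Y) : eqToHom h ∈ homDeg R (1 : H) X Y := by
  subst h; exact id_mem X

variable (R H)

/-- A decomposition of `X` as the direct sum of the family `Y`, by morphisms of degree `1`. -/
structure DegOneSum {J : Type w} [Fintype J] (Y : J → C) (X : C) where
  ι : ∀ j, Y j ⟶ X
  π : ∀ j, X ⟶ Y j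
  ι_mem : ∀ j, ι j ∈ homDeg R (1 : H) (Y j) X
  π_mem : ∀ j, π j ∈ homDeg R (1 : H) X (Y j)
  ι_π : ∀ j, ι j ≫ π j = 𝟙 (Y j)
  ι_π_ne : ∀ j k, j ≠ k → ι j ≫ π k = 0
  total : ∑ j, π j ≫ ι j = 𝟙 X

variable {R H}

/-- Translates between direct sums in `C¹` and their data in `C`, where composites with morphisms of
arbitrary degree make sense. -/
lemma nonempty_degOneSum_iff {J : Type w} [Fintype J] {Y : J → DegOne R H C} {X : DegOne R H C} :
    Nonempty (DegOneSum R H (fun j => (Y j).obj) X.obj) ↔ IsDirectSum Y X := by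
  constructor
  · rintro ⟨d⟩
    refine ⟨fun j => DegOne.mk' (d.ι j) (d.ι_mem j), fun j => DegOne.mk' (d.π j) (d.π_mem j),
      fun j => DegOne.hom_ext (d.ι_π j), fun j k h => DegOne.hom_ext (d.ι_π_ne j k h),
      DegOne.hom_ext ?_⟩
    rw [DegOne.val_sum]
    exact d.total
  · rintro ⟨ι, π, h₁, h₂, h₃⟩
    refine ⟨⟨fun j => DegOne.val (ι j), fun j => DegOne.val (π j), fun j => DegOne.val_mem _,
      fun j => DegOne.val_mem _, fun j => congrArg DegOne.val (h₁ j),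
      fun j k h => congrArg DegOne.val (h₂ j k h), ?_⟩⟩
    have := congrArg DegOne.val h₃
    rw [DegOne.val_sum] at this
    exact this

namespace DegOneSum

variable {J : Type w} [Fintype J] {Y : J → C} {X : C}

lemma ι_π_assoc (d : DegOneSum R H Y X) (j : J) {Z : C} (f : Y j ⟶ Z) :
    d.ι j ≫ d.π j ≫ f = f := by
  rw [← Category.assoc, d.ι_π, Category.id_comp]

lemma sum_ι_π {Z W : C} (d : DegOneSum R H Y X) (j : J) (f : Z ⟶ Y j)
    (g : ∀ k, Y k ⟶ W) : ∑ k, f ≫ d.ι j ≫ d.π k ≫ g k = f ≫ g j := by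
  rw [Finset.sum_eq_single j]
  · rw [d.ι_π_assoc]
  · intro k _ hk
    rw [← Category.assoc (d.ι j), d.ι_π_ne j k hk.symm, zero_comp, comp_zero]
  · intro h; exact absurd (Finset.mem_univ _) h

/-- Matrix multiplication: insert `id = ∑ ι ∘ π` in the middle. -/
lemma comp_eq_sum {Z W : C} (d : DegOneSum R H Y X) (f : Z ⟶ X) (g : X ⟶ W) :
    f ≫ g = ∑ j, (f ≫ d.π j) ≫ (d.ι j ≫ g) := by
  have : ∀ j, (f ≫ d.π j) ≫ (d.ι j ≫ g) = f ≫ (d.π j ≫ d.ι j) ≫ g := fun j => by simp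
  simp only [this]
  rw [← Preadditive.comp_sum, ← Preadditive.sum_comp, d.total, Category.id_comp]

/-- Change of the index type. -/
def reindex {J' : Type*} [Fintype J'] (e : J' ≃ J) (d : DegOneSum R H Y X) :
    DegOneSum R H (fun j => Y (e j)) X where
  ι j := d.ι (e j)
  π j := d.π (e j)
  ι_mem j := d.ι_mem (e j)
  π_mem j := d.π_mem (e j)
  ι_π j := d.ι_π (e j)
  ι_π_ne _ _ h := d.ι_π_ne _ _ fun h' => h (e.injective h')
  total := (Equiv.sum_comp e fun j => d.π j ≫ d.ι j).trans d.total

/-- Replace the sum and the summands by shifts of degree `1`. -/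
lemma congr (d : DegOneSum R H Y X) {Y' : J → C} {X' : C}
    (hY : ∀ j, IsShift R (1 : H) (Y j) (Y' j)) (hX : IsShift R (1 : H) X X') :
    Nonempty (DegOneSum R H Y' X') := by
  choose r h₁ h₂ using hY
  obtain ⟨s, h₃, h₄⟩ := hX
  simp only [inv_one] at h₂ h₄
  refine ⟨⟨fun j => (r j).inv ≫ d.ι j ≫ s.hom, fun j => s.inv ≫ d.π j ≫ (r j).hom,
    fun j => comp_mem_one (h₂ j) (comp_mem_one (d.ι_mem j) h₃),
    fun j => comp_mem_one h₄ (comp_mem_one (d.π_mem j) (h₁ j)), fun j => ?_, fun j k h => ?_, ?_⟩⟩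
  · simp [d.ι_π_assoc]
  · have := d.ι_π_ne j k h
    simp [reassoc_of% this]
  · have := congrArg (fun f => s.inv ≫ f ≫ s.hom) d.total
    simpa [Preadditive.comp_sum, Preadditive.sum_comp] using this

/-- Composition of direct sum decompositions. -/
def sigma (d : DegOneSum R H Y X) {J' : J → Type*} [∀ j, Fintype (J' j)] {Z : ∀ j, J' j → C}
    (d' : ∀ j, DegOneSum R H (Z j) (Y j)) :
    DegOneSum R H (fun p : Σ j, J' j => Z p.1 p.2) X where
  ι p := (d' p.1).ι p.2 ≫ d.ι p.1
  π p := d.π p.1 ≫ (d' p.1).π p.2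
  ι_mem p := comp_mem_one ((d' p.1).ι_mem p.2) (d.ι_mem p.1)
  π_mem p := comp_mem_one (d.π_mem p.1) ((d' p.1).π_mem p.2)
  ι_π p := by simp [d.ι_π_assoc, (d' p.1).ι_π]
  ι_π_ne := by
    rintro ⟨j, a⟩ ⟨k, b⟩ h
    by_cases hjk : j = k
    · subst hjk
      simp [d.ι_π_assoc, (d' j).ι_π_ne a b fun h' => h (by rw [h'])]
    · have := d.ι_π_ne j k hjk
      simp [reassoc_of% this]
  total := by
    rw [Fintype.sum_sigma, ← d.total]
    refine Finset.sum_congr rfl fun j _ => ?_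
    have := congrArg (fun f => d.π j ≫ f ≫ d.ι j) (d' j).total
    simpa [Preadditive.comp_sum, Preadditive.sum_comp] using this

/-- The direct sum of shifts by `a` is a shift by `a` of the direct sum. -/
lemma isShift (d : DegOneSum R H Y X) {Y' : J → C} {X' : C} (d' : DegOneSum R H Y' X') (a : H)
    (h : ∀ j, IsShift R a (Y j) (Y' j)) : IsShift R a X X' := by
  classical
  -- The isomorphism is the diagonal matrix with entries `r j`. The identity `key` is proved for
  -- arbitrary decompositions so that it serves for both composites.
  choose r h₁ h₂ using h
  have key : ∀ {Z Z' : J → C} {W W' : C} (d : DegOneSum R H Z W) (d' : DegOneSum R H Z' W')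
      (r : ∀ j, Z j ≅ Z' j),
      (∑ j, d.π j ≫ (r j).hom ≫ d'.ι j) ≫ (∑ j, d'.π j ≫ (r j).inv ≫ d.ι j) = 𝟙 W := by
    intro Z Z' W W' d d' r
    rw [Preadditive.sum_comp, ← d.total]
    refine Finset.sum_congr rfl fun j _ => ?_
    rw [Preadditive.comp_sum]
    simp only [Category.assoc]
    rw [← Preadditive.comp_sum, sum_ι_π d' j (r j).hom (fun k => (r k).inv ≫ d.ι k)]
    simp
  refine ⟨⟨_, _, key d d' r, key d' d fun j => (r j).symm⟩, ?_, ?_⟩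
  · refine Submodule.sum_mem _ fun j _ => ?_
    simpa using comp_mem (d.π_mem j) (comp_mem (h₁ j) (d'.ι_mem j))
  · refine Submodule.sum_mem _ fun j _ => ?_
    simpa using comp_mem (d'.π_mem j) (comp_mem (h₂ j) (d.ι_mem j))

end DegOneSum

/-! ### Homogeneous objects, `τ`-graded functors and equivalences -/

section Tau

variable {G : Type uG} [Group G] {τ : H →* G} [TauGraded R τ C]
  {D : Type*} [Category* D] [Preadditive D] [Linear R D] [HomGraded R H D] [TauGraded R τ D]
  {D' : Type*} [Category* D'] [Preadditive D'] [Linear R D'] [HomGraded R H D']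
  [TauGraded R τ D']

/-- Homogeneity becomes an orthogonality condition on morphisms of degree 1, so it can be checked
for summands, sums and preimages under functors without touching decompositions. -/
lemma hasDegree_iff {g : G} {X : C} : HasDegree R τ g X ↔ ∀ g' : G, g ≠ g' → ∀ Y : C,
    HasDegree R τ g' Y → ∀ f ∈ homDeg R (1 : H) X Y, f = 0 := by
  refine (ObjGrading.mem_iff _).trans ⟨fun h g' hg Y hY f hf => ?_, fun h g' hg Y hY f => ?_⟩
  · exact congrArg DegOne.val (h g' hg ⟨Y⟩ hY (DegOne.mk' f hf))
  · exact DegOne.hom_ext (h g' hg Y.obj hY (DegOne.val f) (DegOne.val_mem f))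

lemma HasDegree.of_retract {g : G} {X Y : C} (hX : HasDegree R τ g X) {i : Y ⟶ X} {p : X ⟶ Y}
    (hp : p ∈ homDeg R (1 : H) X Y) (hip : i ≫ p = 𝟙 Y) : HasDegree R τ g Y := by
  refine hasDegree_iff.2 fun g' hg Z hZ f hf => ?_
  rw [← Category.id_comp f, ← hip, Category.assoc,
    hasDegree_iff.1 hX g' hg Z hZ (p ≫ f) (comp_mem_one hp hf), comp_zero]

lemma DegOneSum.hasDegree {J : Type w} [Fintype J] {Y : J → C} {X : C} (d : DegOneSum R H Y X)
    {g : G} (h : ∀ j, HasDegree R τ g (Y j)) : HasDegree R τ g X := by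
  refine hasDegree_iff.2 fun g' hg Z hZ f hf => ?_
  rw [← Category.id_comp f, ← d.total, Preadditive.sum_comp]
  refine Finset.sum_eq_zero fun j _ => ?_
  rw [Category.assoc, hasDegree_iff.1 (h j) g' hg Z hZ _ (comp_mem_one (d.ι_mem j) hf), comp_zero]

namespace IsTauFunctor

lemma comp {F : C ⥤ D} {F' : D ⥤ D'} (hF : IsTauFunctor R τ F) (hF' : IsTauFunctor R τ F') :
    IsTauFunctor R τ (F ⋙ F') := by
  have := hF.additive
  have := hF'.additive
  have := hF.linear
  have := hF'.linear
  exact ⟨inferInstance, inferInstance, fun h _ _ f hf => hF'.map_mem h _ (hF.map_mem h f hf),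
    fun g X hX => hF'.obj_degree g _ (hF.obj_degree g X hX)⟩

lemma mem_of_map_mem {F : C ⥤ D} (hF : IsTauFunctor R τ F) [F.Faithful] {h : H} {X Y : C}
    {f : X ⟶ Y} (hf : F.map f ∈ homDeg R h (F.obj X) (F.obj Y)) : f ∈ homDeg R h X Y := by
  have := hF.additive
  have := hF.linear
  exact mem_of_map_mem_of_iSupIndep (N := fun h => homDeg R h X Y)
    (N' := fun h => homDeg R h (F.obj X) (F.obj Y)) (F.mapLinearMap R) F.map_injective
    (HomGraded.iSup_eq_top X Y) (HomGraded.indep _ _) (fun h m hm => hF.map_mem h m hm) hf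

/-- A morphism of degree 1 to an object of another degree is killed by `F`, by orthogonality in `D`,
hence vanishes by faithfulness. -/
lemma hasDegree_of_map {F : C ⥤ D} (hF : IsTauFunctor R τ F) [F.Faithful] {g : G} {X : C}
    (hX : HasDegree R τ g (F.obj X)) : HasDegree R τ g X := by
  have := hF.additive
  refine hasDegree_iff.2 fun g' hg Y hY f hf => F.map_injective ?_
  rw [F.map_zero]
  exact hasDegree_iff.1 hX g' hg _ (hF.obj_degree g' Y hY) _ (hF.map_mem 1 f hf)

lemma isShift {F : C ⥤ D} (hF : IsTauFunctor R τ F) {a : H} {X Y : C} (h : IsShift R a X Y) :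
    IsShift R a (F.obj X) (F.obj Y) := by
  obtain ⟨r, h₁, h₂⟩ := h
  exact ⟨F.mapIso r, hF.map_mem _ _ h₁, hF.map_mem _ _ h₂⟩

/-- The image of a direct sum decomposition. -/
def mapSum {F : C ⥤ D} (hF : IsTauFunctor R τ F) {J : Type w} [Fintype J] {Y : J → C} {X : C}
    (d : DegOneSum R H Y X) : DegOneSum R H (fun j => F.obj (Y j)) (F.obj X) where
  ι j := F.map (d.ι j)
  π j := F.map (d.π j)
  ι_mem j := hF.map_mem _ _ (d.ι_mem j)
  π_mem j := hF.map_mem _ _ (d.π_mem j)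
  ι_π j := by rw [← F.map_comp, d.ι_π, F.map_id]
  ι_π_ne j k h := by
    have := hF.additive
    rw [← F.map_comp, d.ι_π_ne j k h, F.map_zero]
  total := by
    have := hF.additive
    simp_rw [← F.map_comp]
    rw [← F.map_sum, d.total, F.map_id]

/-- A fully faithful `τ`-graded functor which is essentially surjective by isomorphisms of
degree `1` is part of a `τ`-graded equivalence. -/
lemma tauEquivalent {F : D ⥤ C} (hF : IsTauFunctor R τ F) [F.Full] [F.Faithful]
    (hsurj : ∀ X : C, ∃ Y : D, IsShift R (1 : H) (F.obj Y) X) : TauEquivalent R τ C D := by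
  have := hF.additive
  have := hF.linear
  -- The quasi-inverse is obtained by conjugating with the chosen degree 1 isomorphisms `r X`. Since
  -- `F` reflects degrees of morphisms and of objects, all gradedness claims can be checked after
  -- applying `F`.
  choose E r h₁ h₂ using hsurj
  simp only [inv_one] at h₂
  let E' : C ⥤ D :=
    { obj := E
      map := fun {X Y} f => F.preimage ((r X).hom ≫ f ≫ (r Y).inv)
      map_id := fun X => F.map_injective (by simp)
      map_comp := fun f g => F.map_injective (by simp) }
  have hE' : ∀ {X Y : C} (f : X ⟶ Y), F.map (E'.map f) = (r X).hom ≫ f ≫ (r Y).inv :=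
    fun f => F.map_preimage _
  let e : C ≌ D :=
    { functor := E'
      inverse := F
      unitIso := NatIso.ofComponents (fun X => (r X).symm) (fun f => by simp [hE'])
      counitIso := NatIso.ofComponents (fun Y => F.preimageIso (r (F.obj Y)))
        (fun f => F.map_injective (by simp [hE']))
      functor_unitIso_comp := fun X => F.map_injective (by simp [hE']) }
  refine ⟨e, ⟨⟨?_⟩, ⟨?_⟩, ?_, ?_⟩, hF, fun X => ⟨h₂ X, h₁ X⟩, fun Y => ⟨?_, ?_⟩⟩
  · intro X Y f g
    exact F.map_injective (by rw [F.map_add]; simp [e, hE'])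
  · intro X Y f c
    exact F.map_injective (by rw [F.map_smul]; simp [e, hE'])
  · intro h X Y f hf
    refine hF.mem_of_map_mem ?_
    change F.map (E'.map f) ∈ _
    rw [hE']
    simpa using comp_mem (h₁ X) (comp_mem hf (h₂ Y))
  · intro g X hX
    exact hF.hasDegree_of_map (hX.of_retract (h₂ X) (r X).hom_inv_id)
  · refine hF.mem_of_map_mem ?_
    change F.map (F.preimage _) ∈ _
    rw [F.map_preimage]
    exact h₁ _
  · refine hF.mem_of_map_mem ?_
    change F.map (F.preimage _) ∈ _
    rw [F.map_preimage]
    exact h₂ _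

end IsTauFunctor

end Tau

end Basics

/-! ### Extending functors to direct sums -/

section Matrices

variable {R : Type uR} [CommRing R] {H : Type uH} [Group H] {C : Type*} [Category* C]
  [Preadditive C] [Linear R C] [HomGraded R H C] {D : Type*} [Category* D]
  [Preadditive D] [Linear R D] [HomGraded R H D] {K : Type*}

variable (R H) in
/-- An isomorphism between the full subcategories on two families of objects `E` and `P`, which is
linear and preserves degrees. -/
structure FamilyIso (E : K → D) (P : K → C) where
  φ : ∀ k l, (E k ⟶ E l) ≃ₗ[R] (P k ⟶ P l)
  map_id : ∀ k, φ k k (𝟙 _) = 𝟙 _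
  map_comp : ∀ {k l m} (f : E k ⟶ E l) (g : E l ⟶ E m), φ k m (f ≫ g) = φ k l f ≫ φ l m g
  map_mem : ∀ {k l} (h : H) (f : E k ⟶ E l), f ∈ homDeg R h _ _ → φ k l f ∈ homDeg R h _ _

namespace FamilyIso

variable {E : K → D} {P : K → C}

/-- The inverse isomorphism. -/
def symm (B : FamilyIso R H E P) : FamilyIso R H P E where
  φ k l := (B.φ k l).symm
  map_id k := by rw [LinearEquiv.symm_apply_eq, B.map_id]
  map_comp f g := by rw [LinearEquiv.symm_apply_eq, B.map_comp]; simp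
  map_mem {k l} h f hf :=
    mem_of_map_mem_of_iSupIndep (N := fun h => homDeg R h (E k) (E l))
      (N' := fun h => homDeg R h (P k) (P l)) (B.φ k l).toLinearMap (B.φ k l).injective
      (HomGraded.iSup_eq_top _ _) (HomGraded.indep _ _) (fun h m hm => B.map_mem h m hm)
      (by simpa using hf)

section

variable (B : FamilyIso R H E P) {J₁ J₂ : Type*} [Fintype J₁] [Fintype J₂] {k₁ : J₁ → K}
  {k₂ : J₂ → K} {Y₁ Y₂ : D} {X₁ X₂ : C}
  (d₁ : DegOneSum R H (fun j => E (k₁ j)) Y₁) (d₂ : DegOneSum R H (fun j => E (k₂ j)) Y₂)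
  (c₁ : DegOneSum R H (fun j => P (k₁ j)) X₁) (c₂ : DegOneSum R H (fun j => P (k₂ j)) X₂)

/-- The morphism between direct sums of members of `P` with the same matrix as `f`. -/
def matMap (f : Y₁ ⟶ Y₂) : X₁ ⟶ X₂ :=
  ∑ j, ∑ l, c₁.π j ≫ B.φ (k₁ j) (k₂ l) (d₁.ι j ≫ f ≫ d₂.π l) ≫ c₂.ι l

lemma matMap_add (f g : Y₁ ⟶ Y₂) :
    B.matMap d₁ d₂ c₁ c₂ (f + g) = B.matMap d₁ d₂ c₁ c₂ f + B.matMap d₁ d₂ c₁ c₂ g := by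
  simp only [matMap, Preadditive.add_comp, Preadditive.comp_add, map_add, Finset.sum_add_distrib]

lemma matMap_smul (r : R) (f : Y₁ ⟶ Y₂) :
    B.matMap d₁ d₂ c₁ c₂ (r • f) = r • B.matMap d₁ d₂ c₁ c₂ f := by
  simp only [matMap, Linear.smul_comp, Linear.comp_smul, map_smul, Finset.smul_sum]

lemma matMap_mem {h : H} {f : Y₁ ⟶ Y₂} (hf : f ∈ homDeg R h Y₁ Y₂) :
    B.matMap d₁ d₂ c₁ c₂ f ∈ homDeg R h X₁ X₂ := by
  refine Submodule.sum_mem _ fun j _ => Submodule.sum_mem _ fun l _ => ?_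
  have := B.map_mem h _ (by simpa using comp_mem (d₁.ι_mem j) (comp_mem hf (d₂.π_mem l)))
  simpa using comp_mem (c₁.π_mem j) (comp_mem this (c₂.ι_mem l))

/-- The entries of `matMap f` are the images under `B` of those of `f`. Together with
`DegOneSum.hom_ext`, this reduces every identity between such morphisms to one between entries. -/
lemma ι_matMap_π (f : Y₁ ⟶ Y₂) (j : J₁) (l : J₂) :
    c₁.ι j ≫ B.matMap d₁ d₂ c₁ c₂ f ≫ c₂.π l = B.φ _ _ (d₁.ι j ≫ f ≫ d₂.π l) := by
  classical
  simp only [matMap, Preadditive.sum_comp, Preadditive.comp_sum, Category.assoc]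
  rw [Finset.sum_eq_single j, Finset.sum_eq_single l]
  · rw [c₁.ι_π_assoc, c₂.ι_π, Category.comp_id]
  · intro l' _ hl
    rw [c₂.ι_π_ne _ _ hl, comp_zero, comp_zero, comp_zero]
  · intro h; exact absurd (Finset.mem_univ _) h
  · intro j' _ hj
    refine Finset.sum_eq_zero fun l' _ => ?_
    rw [← Category.assoc (c₁.ι j), c₁.ι_π_ne _ _ hj.symm, zero_comp]
  · intro h; exact absurd (Finset.mem_univ _) h

end

end FamilyIso

lemma DegOneSum.hom_ext {J₁ J₂ : Type*} [Fintype J₁] [Fintype J₂] {Y₁ : J₁ → C} {Y₂ : J₂ → C}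
    {X₁ X₂ : C} (c₁ : DegOneSum R H Y₁ X₁) (c₂ : DegOneSum R H Y₂ X₂) {f g : X₁ ⟶ X₂}
    (h : ∀ j l, c₁.ι j ≫ f ≫ c₂.π l = c₁.ι j ≫ g ≫ c₂.π l) : f = g := by
  have key : ∀ f : X₁ ⟶ X₂, f = ∑ j, ∑ l, c₁.π j ≫ (c₁.ι j ≫ f ≫ c₂.π l) ≫ c₂.ι l := by
    intro f
    have e₁ : ∀ j, ∑ l, c₁.π j ≫ (c₁.ι j ≫ f ≫ c₂.π l) ≫ c₂.ι l = (c₁.π j ≫ c₁.ι j) ≫ f := by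
      intro j
      simp only [Category.assoc]
      rw [← Preadditive.comp_sum, ← Preadditive.comp_sum, ← Preadditive.comp_sum, c₂.total,
        Category.comp_id]
    simp only [e₁]
    rw [← Preadditive.sum_comp, c₁.total, Category.id_comp]
  rw [key f, key g]
  simp only [h]

namespace FamilyIso

variable {E : K → D} {P : K → C} (B : FamilyIso R H E P) {J₁ J₂ J₃ : Type*} [Fintype J₁]
  [Fintype J₂] [Fintype J₃] {k₁ : J₁ → K} {k₂ : J₂ → K} {k₃ : J₃ → K} {Y₁ Y₂ Y₃ : D}
  {X₁ X₂ X₃ : C} (d₁ : DegOneSum R H (fun j => E (k₁ j)) Y₁)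
  (d₂ : DegOneSum R H (fun j => E (k₂ j)) Y₂) (d₃ : DegOneSum R H (fun j => E (k₃ j)) Y₃)
  (c₁ : DegOneSum R H (fun j => P (k₁ j)) X₁) (c₂ : DegOneSum R H (fun j => P (k₂ j)) X₂)
  (c₃ : DegOneSum R H (fun j => P (k₃ j)) X₃)

/-- Compare entries: both sides are given by the matrix product, and `B` is additive and
multiplicative. -/
lemma matMap_comp (f : Y₁ ⟶ Y₂) (g : Y₂ ⟶ Y₃) :
    B.matMap d₁ d₃ c₁ c₃ (f ≫ g) = B.matMap d₁ d₂ c₁ c₂ f ≫ B.matMap d₂ d₃ c₂ c₃ g := by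
  refine c₁.hom_ext c₃ fun j l => ?_
  rw [ι_matMap_π]
  have h₁ := d₂.comp_eq_sum (d₁.ι j ≫ f) (g ≫ d₃.π l)
  have h₂ := c₂.comp_eq_sum (c₁.ι j ≫ B.matMap d₁ d₂ c₁ c₂ f) (B.matMap d₂ d₃ c₂ c₃ g ≫ c₃.π l)
  simp only [Category.assoc] at h₁ h₂ ⊢
  rw [h₁, h₂, map_sum]
  refine Finset.sum_congr rfl fun m _ => ?_
  have := B.map_comp (d₁.ι j ≫ f ≫ d₂.π m) (d₂.ι m ≫ g ≫ d₃.π l)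
  rw [← B.ι_matMap_π d₁ d₂ c₁ c₂, ← B.ι_matMap_π d₂ d₃ c₂ c₃] at this
  simpa using this

lemma matMap_id : B.matMap d₁ d₁ c₁ c₁ (𝟙 Y₁) = 𝟙 X₁ := by
  refine c₁.hom_ext c₁ fun j l => ?_
  rw [ι_matMap_π]
  by_cases h : j = l
  · subst h
    simp [d₁.ι_π, c₁.ι_π, B.map_id]
  · simp [d₁.ι_π_ne j l h, c₁.ι_π_ne j l h]

lemma symm_matMap_matMap (f : Y₁ ⟶ Y₂) :
    B.symm.matMap c₁ c₂ d₁ d₂ (B.matMap d₁ d₂ c₁ c₂ f) = f := by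
  refine d₁.hom_ext d₂ fun j l => ?_
  rw [ι_matMap_π, ι_matMap_π]
  exact (B.φ _ _).symm_apply_apply _

/-- Direct sums of members of `P` are determined by the direct sum of members of `E`. -/
lemma isShift (B : FamilyIso R H E P) (d₁ : DegOneSum R H (fun j => E (k₁ j)) Y₁)
    (c₁ : DegOneSum R H (fun j => P (k₁ j)) X₁) (d₂ : DegOneSum R H (fun j => E (k₂ j)) Y₁)
    (c₂ : DegOneSum R H (fun j => P (k₂ j)) X₂) : IsShift R (1 : H) X₁ X₂ := by
  -- The change-of-decomposition matrix of `Y₁`, transported to `C`, is the isomorphism.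
  refine ⟨⟨B.matMap d₁ d₂ c₁ c₂ (𝟙 Y₁), B.matMap d₂ d₁ c₂ c₁ (𝟙 Y₁), ?_, ?_⟩,
    B.matMap_mem _ _ _ _ (id_mem Y₁), ?_⟩
  · rw [← B.matMap_comp, Category.comp_id, B.matMap_id]
  · rw [← B.matMap_comp, Category.comp_id, B.matMap_id]
  · simpa using B.matMap_mem d₂ d₁ c₂ c₁ (id_mem (R := R) (H := H) Y₁)

/-- Given decompositions of all objects of `D` into members of `E`, and corresponding direct sums
of members of `P`, the extension of `B` to a functor. -/
@[simps] def functor {J : D → Type} [∀ Y, Fintype (J Y)] {k : ∀ Y, J Y → K}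
    (d : ∀ Y, DegOneSum R H (fun j => E (k Y j)) Y) {X : D → C}
    (c : ∀ Y, DegOneSum R H (fun j => P (k Y j)) (X Y)) : D ⥤ C where
  obj := X
  map {Y Y'} f := B.matMap (d Y) (d Y') (c Y) (c Y') f
  map_id _ := B.matMap_id _ _
  map_comp f g := B.matMap_comp _ _ _ _ _ _ f g

end FamilyIso

end Matrices

/-! ### Categories generated by full subcategories under direct sums -/

section Generating

variable (R : Type uR) [CommRing R] {H : Type uH} [Group H] {G : Type uG} [Group G] (τ : H →* G)
  {I : Type w} {K : I → Type*} [∀ i, Category* (K i)] [∀ i, Preadditive (K i)]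
  [∀ i, Linear R (K i)] [∀ i, HomGraded R H (K i)] [∀ i, TauGraded R τ (K i)]
  {C : Type*} [Category* C] [Preadditive C] [Linear R C] [HomGraded R H C] [TauGraded R τ C]
  {D : Type*} [Category* D] [Preadditive D] [Linear R D] [HomGraded R H D] [TauGraded R τ D]

/-- The functors `P i` embed the `K i` as mutually disjoint full subcategories of `C`, such that
`C` is the completion of their union under finite direct sums. -/
structure IsGenerating (P : ∀ i, K i ⥤ C) : Prop where
  tau : ∀ i, IsTauFunctor R τ (P i)
  full : ∀ i, (P i).Full
  faithful : ∀ i, (P i).Faithful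
  cross : ∀ {i j}, i ≠ j → ∀ {x y} (f : (P i).obj x ⟶ (P j).obj y), f = 0
  decomp : ∀ X : C, ∃ (J : Type) (_ : Fintype J) (k : J → Σ i, K i),
    Nonempty (DegOneSum R H (fun j => (P (k j).1).obj (k j).2) X)
  sums : ∀ {J : Type} [Fintype J] (Y : J → C), ∃ X, Nonempty (DegOneSum R H Y X)

namespace IsGenerating

variable {R τ} {P : ∀ i, K i ⥤ C} {E : ∀ i, K i ⥤ D}

/-- Within one `K i`, undo the fully faithful `E i` and apply `P i`; between different `K i` both
hom-modules are zero. Degrees are preserved because `E i` also reflects them. -/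
lemma exists_familyIso (hE : IsGenerating R τ E) (hP : IsGenerating R τ P) :
    Nonempty (FamilyIso R H (fun k : Σ i, K i => (E k.1).obj k.2)
      (fun k => (P k.1).obj k.2)) := by
  classical
  have hEf := hE.full
  have hEf' := hE.faithful
  have hPf := hP.full
  have hPf' := hP.faithful
  have hEa := fun i => (hE.tau i).additive
  have hPa := fun i => (hP.tau i).additive
  have hEl := fun i => (hE.tau i).linear
  have hPl := fun i => (hP.tau i).linear
  let eE := fun i (x y : K i) => LinearEquiv.ofBijective ((E i).mapLinearMap R (X := x) (Y := y))
    ⟨(E i).map_injective, (E i).map_surjective⟩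
  let eP := fun i (x y : K i) => LinearEquiv.ofBijective ((P i).mapLinearMap R (X := x) (Y := y))
    ⟨(P i).map_injective, (P i).map_surjective⟩
  -- The zero map is an equivalence here, by disjointness on both sides.
  let z : ∀ {i j} (_ : i ≠ j) (x : K i) (y : K j),
      ((E i).obj x ⟶ (E j).obj y) ≃ₗ[R] ((P i).obj x ⟶ (P j).obj y) := fun h x y =>
    { toFun := 0
      invFun := 0
      map_add' := by simp
      map_smul' := by simp
      left_inv := fun f => (hE.cross h f).symm
      right_inv := fun f => (hP.cross h f).symm }
  let φ : ∀ k l : Σ i, K i, ((E k.1).obj k.2 ⟶ (E l.1).obj l.2) ≃ₗ[R]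
      ((P k.1).obj k.2 ⟶ (P l.1).obj l.2) := fun k l =>
    match k, l with
    | ⟨i, x⟩, ⟨j, y⟩ =>
      if h : i = j then by
        subst h
        exact (eE i x y).symm.trans (eP i x y)
      else z h x y
  have hφ : ∀ i (x y : K i) (f : x ⟶ y), φ ⟨i, x⟩ ⟨i, y⟩ ((E i).map f) = (P i).map f := by
    intro i x y f
    have : φ ⟨i, x⟩ ⟨i, y⟩ = (eE i x y).symm.trans (eP i x y) := dif_pos rfl
    rw [this, LinearEquiv.trans_apply]
    exact congrArg (eP i x y) ((eE i x y).symm_apply_apply f)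
  refine ⟨⟨φ, ?_, ?_, ?_⟩⟩
  · rintro ⟨i, x⟩
    have := hφ i x x (𝟙 x)
    rw [(E i).map_id, (P i).map_id] at this
    exact this
  · rintro ⟨i, x⟩ ⟨j, y⟩ ⟨m, t⟩ f g
    by_cases hij : i = j
    · subst hij
      by_cases him : i = m
      · subst him
        obtain ⟨f, rfl⟩ := (E i).map_surjective f
        obtain ⟨g, rfl⟩ := (E i).map_surjective g
        dsimp only
        rw [← (E i).map_comp, hφ, hφ, hφ, (P i).map_comp]
      · rw [hE.cross him g]
        simp
    · rw [hE.cross hij f]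
      simp
  · rintro ⟨i, x⟩ ⟨j, y⟩ h f hf
    by_cases hij : i = j
    · subst hij
      obtain ⟨f, rfl⟩ := (E i).map_surjective f
      rw [hφ]
      exact (hP.tau i).map_mem h f ((hE.tau i).mem_of_map_mem hf)
    · rw [hP.cross hij (φ ⟨i, x⟩ ⟨j, y⟩ f)]
      exact Submodule.zero_mem _

/-- Categories which are generated by the same subcategories are `τ`-graded equivalent. -/
lemma tauEquivalent (hP : IsGenerating R τ P) (hE : IsGenerating R τ E) :
    TauEquivalent R τ C D := by
  obtain ⟨B⟩ := exists_familyIso hE hP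
  choose J hJ k hd using hE.decomp
  have d := fun Y => (hd Y).some
  choose X hc using fun Y => hP.sums fun j : J Y => (P (k Y j).1).obj (k Y j).2
  have c := fun Y => (hc Y).some
  let F : D ⥤ C := B.functor (k := k) d c
  have hF : IsTauFunctor R τ F := by
    refine ⟨⟨?_⟩, ⟨?_⟩, ?_, ?_⟩
    · intro Y Y' f g
      exact B.matMap_add _ _ _ _ f g
    · intro Y Y' f r
      exact B.matMap_smul _ _ _ _ r f
    · intro h Y Y' f hf
      exact B.matMap_mem _ _ _ _ hf
    · intro g Y hY
      -- The degree travels from `Y` to its summand `E k` as a retract, back to `k` because `E`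
      -- reflects degrees, and on to `P k` and the sum of these.
      refine (c Y).hasDegree fun j => (hP.tau _).obj_degree g _ ?_
      have := hE.faithful
      exact (hE.tau _).hasDegree_of_map (hY.of_retract ((d Y).π_mem j) ((d Y).ι_π j))
  have : F.Faithful := ⟨fun {Y Y'} f g h => by
    rw [← B.symm_matMap_matMap (d Y) (d Y') (c Y) (c Y') f,
      ← B.symm_matMap_matMap (d Y) (d Y') (c Y) (c Y') g]
    exact congrArg _ h⟩
  have : F.Full := ⟨fun {Y Y'} f => ⟨B.symm.matMap (c Y) (c Y') (d Y) (d Y') f,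
    B.symm.symm_matMap_matMap (c Y) (c Y') (d Y) (d Y') f⟩⟩
  refine hF.tauEquivalent fun Z => ?_
  -- Mirror the decomposition of `Z` by an object `Y` of `D`. The decomposition previously chosen
  -- for `Y` may differ from this one, but `FamilyIso.isShift` shows that both give the same object
  -- of `C` up to degree 1.
  obtain ⟨J', _, k', ⟨c'⟩⟩ := hP.decomp Z
  obtain ⟨Y, ⟨d'⟩⟩ := hE.sums fun j => (E (k' j).1).obj (k' j).2
  exact ⟨Y, B.isShift (d Y) (c Y) d' c'⟩

/-- Transport along a `τ`-graded equivalence. -/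
lemma of_tauEquivalent (hE : IsGenerating R τ E) (h : TauEquivalent R τ C D) :
    ∃ P : ∀ i, K i ⥤ C, IsGenerating R τ P := by
  obtain ⟨e, he, he', hu, -⟩ := h
  have hiso : ∀ X : C, IsShift R (1 : H) (e.inverse.obj (e.functor.obj X)) X := fun X =>
    ⟨(e.unitIso.app X).symm, (hu X).2, by simpa using (hu X).1⟩
  have := hE.full
  have := hE.faithful
  have := he'.additive
  refine ⟨fun i => E i ⋙ e.inverse, fun i => (hE.tau i).comp he', fun i => inferInstance,
    fun i => inferInstance, fun {i j} h x y f => ?_, fun X => ?_, fun {J} _ Y => ?_⟩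
  · obtain ⟨f, rfl⟩ := e.inverse.map_surjective f
    rw [hE.cross h f, e.inverse.map_zero]
  · obtain ⟨J, _, k, ⟨d⟩⟩ := hE.decomp (e.functor.obj X)
    exact ⟨J, _, k, (he'.mapSum d).congr (fun _ => IsShift.refl _) (hiso X)⟩
  · obtain ⟨X, ⟨d⟩⟩ := hE.sums fun j => e.functor.obj (Y j)
    exact ⟨_, (he'.mapSum d).congr (fun j => hiso (Y j)) (IsShift.refl _)⟩

end IsGenerating

end Generating

/-! ### Direct sums in matrix categories -/

namespace MatGrading

variable {R : Type uR} [CommRing R] {H : Type uH} [Group H] {G : Type uG} [Group G]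
  {τ : H →* G} {C : Type u} [Category.{v} C] [Preadditive C] [Linear R C] [HomGraded R H C]

open scoped Classical in
/-- Concatenating the index sets of formal direct sums gives a direct sum. -/
def degOneSum {J : Type*} [Fintype J] (Y : J → Mat_ C) (M : Mat_ C)
    (e : (Σ j, (Y j).ι) ≃ M.ι) (he : ∀ p, (Y p.1).X p.2 = M.X (e p)) : DegOneSum R H Y M := by
  let ι : ∀ j, Y j ⟶ M := fun j a b =>
    if h : e ⟨j, a⟩ = b then eqToHom ((he ⟨j, a⟩).trans (by rw [h])) else 0
  let π : ∀ j, M ⟶ Y j := fun j b a =>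
    if h : e ⟨j, a⟩ = b then eqToHom ((he ⟨j, a⟩).trans (by rw [h])).symm else 0
  have hι : ∀ j a, ι j a (e ⟨j, a⟩) = eqToHom (he ⟨j, a⟩) := fun j a => dif_pos rfl
  have hπ : ∀ j a, π j (e ⟨j, a⟩) a = eqToHom (he ⟨j, a⟩).symm := fun j a => dif_pos rfl
  have hι' : ∀ j a b, e ⟨j, a⟩ ≠ b → ι j a b = 0 := fun j a b h => dif_neg h
  have hπ' : ∀ j a b, e ⟨j, a⟩ ≠ b → π j b a = 0 := fun j a b h => dif_neg h
  have hιπ : ∀ j k (a : (Y j).ι) (b : (Y k).ι),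
      (ι j ≫ π k) a b = eqToHom (he ⟨j, a⟩) ≫ π k (e ⟨j, a⟩) b := by
    intro j k a b
    rw [Mat_.comp_apply, Finset.sum_eq_single (e ⟨j, a⟩), hι]
    · intro c _ hc
      rw [hι' j a c hc.symm, zero_comp]
    · intro h; exact absurd (Finset.mem_univ _) h
  -- The coprojections and projections are permutation-type matrices with entries 0 or `eqToHom`;
  -- injectivity of `e` gives orthogonality and surjectivity gives the total sum.
  refine ⟨ι, π, fun j => ?_, fun j => ?_, fun j => ?_, fun j k hjk => ?_, ?_⟩
  · intro a b
    by_cases h : e ⟨j, a⟩ = b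
    · subst h
      rw [hι]
      exact eqToHom_mem_homDeg _
    · rw [hι' j a b h]
      exact Submodule.zero_mem _
  · intro b a
    by_cases h : e ⟨j, a⟩ = b
    · subst h
      rw [hπ]
      exact eqToHom_mem_homDeg _
    · rw [hπ' j a b h]
      exact Submodule.zero_mem _
  · ext a b
    rw [hιπ]
    by_cases h : a = b
    · subst h
      rw [hπ, Mat_.id_apply_self, eqToHom_trans, eqToHom_refl]
    · rw [Mat_.id_apply_of_ne _ _ _ h, hπ', comp_zero]
      intro h'
      exact h (by simpa using (e.injective h').symm)
  · ext a b
    rw [hιπ, hπ', comp_zero]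
    · rfl
    · intro h'
      exact hjk (congrArg Sigma.fst (e.injective h')).symm
  · ext b c
    obtain ⟨⟨j, a⟩, rfl⟩ := e.surjective b
    have key : ∀ k, (π k ≫ ι k) (e ⟨j, a⟩) c =
        if k = j then eqToHom (he ⟨j, a⟩).symm ≫ ι j a c else 0 := by
      intro k
      rw [Mat_.comp_apply]
      split_ifs with h
      · subst h
        rw [Finset.sum_eq_single a, hπ]
        · intro a' _ ha
          rw [hπ', zero_comp]
          intro h'
          exact ha (by simpa using e.injective h')
        · intro h; exact absurd (Finset.mem_univ _) h
      · refine Finset.sum_eq_zero fun a' _ => ?_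
        rw [hπ', zero_comp]
        intro h'
        exact h (congrArg Sigma.fst (e.injective h'))
    rw [sum_apply]
    simp only [key, Finset.sum_ite_eq', Finset.mem_univ, if_true]
    by_cases h : e ⟨j, a⟩ = c
    · subst h
      rw [hι, eqToHom_trans, eqToHom_refl, Mat_.id_apply_self]
    · rw [hι' _ _ _ h, comp_zero, Mat_.id_apply_of_ne _ _ _ h]

lemma nonempty_degOneSum_embedding (M : Mat_ C) :
    Nonempty (DegOneSum R H (fun i => (Mat_.embedding C).obj (M.X i)) M) :=
  ⟨degOneSum _ M (Equiv.sigmaPUnit M.ι) fun _ => rfl⟩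

lemma exists_degOneSum {J : Type} [Fintype J] (Y : J → Mat_ C) :
    ∃ M, Nonempty (DegOneSum R H Y M) :=
  ⟨{ ι := Σ j, (Y j).ι, X := fun p => (Y p.1).X p.2 }, ⟨degOneSum _ _ (Equiv.refl _) fun _ => rfl⟩⟩

lemma isTauFunctor_embedding [TauGraded R τ C] : IsTauFunctor R τ (Mat_.embedding C) where
  additive := inferInstance
  linear := ⟨fun _ _ => rfl⟩
  map_mem _ _ _ _ hf _ _ := hf
  obj_degree _ _ hX _ := hX

end MatGrading

/-! ### Direct sums of categories -/

namespace BoxSum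

variable (R : Type uR) [CommRing R] {H : Type uH} [Group H] {G : Type uG} [Group G]
  {τ : H →* G} {I : Type w} {C : I → Type u} [∀ i, Category.{v} (C i)]
  [∀ i, Preadditive (C i)] [∀ i, Linear R (C i)]

omit [∀ i, Preadditive (C i)] in
lemma hom_congr {X Y : BoxSum C} {f g : X ⟶ Y} (h : f = g) (i : I) : f i = g i := by rw [h]

omit [∀ i, Preadditive (C i)] in
lemma comp_apply {X Y Z : BoxSum C} (f : X ⟶ Y) (g : Y ⟶ Z) (i : I) : (f ≫ g) i = f i ≫ g i := rfl

lemma inc_comp_inc {X Y Z : BoxSum C} (i : I) (f : X.obj i ⟶ Y.obj i) (g : Y.obj i ⟶ Z.obj i) :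
    inc R (X := X) (Y := Y) i f ≫ inc R (X := Y) (Y := Z) i g = inc R i (f ≫ g) := by
  refine hom_ext fun m => ?_
  rw [comp_apply]
  by_cases h : m = i
  · subst h
    rw [inc_same, inc_same, inc_same]
  · rw [inc_ne h, inc_ne h, inc_ne h, comp_zero]

lemma inc_comp_inc_of_ne {X Y Z : BoxSum C} {i j : I} (hij : i ≠ j) (f : X.obj i ⟶ Y.obj i)
    (g : Y.obj j ⟶ Z.obj j) :
    inc R (X := X) (Y := Y) i f ≫ inc R (X := Y) (Y := Z) j g = 0 := by
  refine hom_ext fun m => ?_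
  rw [comp_apply]
  by_cases h : m = i
  · subst h
    rw [inc_ne hij, comp_zero]
    rfl
  · rw [inc_ne h, zero_comp]
    rfl

lemma inc_mem [∀ i, HomGraded R H (C i)] {X Y : BoxSum C} {h : H} {i : I}
    {f : X.obj i ⟶ Y.obj i} (hf : f ∈ homDeg R h (X.obj i) (Y.obj i)) :
    inc R (X := X) (Y := Y) i f ∈ homDeg R h X Y := by
  intro m
  by_cases hm : m = i
  · subst hm
    rw [inc_same]
    exact hf
  · rw [inc_ne hm]
    exact Submodule.zero_mem _

variable [∀ i, HasZeroObject (C i)]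

open scoped Classical ZeroObject in
/-- The family with a single nonzero member. -/
def single (i : I) (X : C i) : BoxSum C where
  obj := Function.update (fun _ => 0) i X
  finite := (Set.finite_singleton i).subset fun j hj => by
    by_contra h
    refine hj ?_
    rw [Function.update_of_ne h]
    exact isZero_zero _

omit [∀ i, Preadditive (C i)] in
lemma single_same (i : I) (X : C i) : (single i X).obj i = X := by
  simp [single]

omit [∀ i, Preadditive (C i)] in
open scoped ZeroObject in
lemma isZero_single {i j : I} (h : j ≠ i) (X : C i) : IsZero ((single i X).obj j) := by
  have : (single i X).obj j = 0 := by
    simp [single, h]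
  rw [this]
  exact isZero_zero _

/-- The embedding of a member into the direct sum. -/
def embedding (i : I) : C i ⥤ BoxSum C where
  obj := single i
  map {X Y} f :=
    -- The `i`-th member of `single i X` equals `X` only propositionally, hence the transports.
    inc R i (eqToHom (single_same i X) ≫ f ≫ eqToHom (single_same i Y).symm)
  map_id X := hom_ext fun m => by
    by_cases h : m = i
    · subst h
      rw [inc_same]
      simp
      rfl
    · exact (isZero_single h X).eq_of_src _ _
  map_comp f g := by
    rw [inc_comp_inc]
    simp

lemma embedding_map {i : I} {X Y : C i} (f : X ⟶ Y) : (embedding (C := C) R i).map f =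
    inc R (X := single i X) (Y := single i Y) i
      (eqToHom (single_same i X) ≫ f ≫ eqToHom (single_same i Y).symm) := rfl

instance (i : I) : (embedding (C := C) R i).Additive where
  map_add {X Y f g} := by
    refine Eq.trans (congrArg (inc R (X := single i X) (Y := single i Y) i) ?_) (map_add (inc R (X := single i X) (Y := single i Y) i) _ _)
    simp

instance (i : I) : (embedding (C := C) R i).Linear R where
  map_smul {X Y} f r := by
    refine Eq.trans (congrArg (inc R (X := single i X) (Y := single i Y) i) ?_) (map_smul (inc R (X := single i X) (Y := single i Y) i) _ _)
    simp

instance (i : I) : (embedding (C := C) R i).Faithful where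
  map_injective {X Y} f g h := by
    rw [embedding_map, embedding_map] at h
    have := hom_congr h i
    rw [inc_same, inc_same] at this
    exact (cancel_mono _).1 ((cancel_epi _).1 this)

instance (i : I) : (embedding (C := C) R i).Full where
  map_surjective {X Y} f := by
    let f' : single i X ⟶ single i Y := f
    refine ⟨eqToHom (single_same i X).symm ≫ f' i ≫ eqToHom (single_same i Y), ?_⟩
    rw [embedding_map]
    change _ = f'
    refine hom_ext fun m => ?_
    by_cases h : m = i
    · subst h
      rw [inc_same]
      simp
    · exact (isZero_single h X).eq_of_src _ _

lemma embedding_cross {i j : I} (hij : i ≠ j) {X : C i} {Y : C j}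
    (f : (embedding R i).obj X ⟶ (embedding R j).obj Y) : f = 0 := by
  refine hom_ext fun m => ?_
  by_cases h : m = i
  · subst h
    exact (isZero_single hij Y).eq_of_tgt _ _
  · exact (isZero_single h X).eq_of_src _ _

variable [∀ i, HomGraded R H (C i)]

lemma isTauFunctor_embedding [∀ i, TauGraded R τ (C i)] (i : I) :
    IsTauFunctor R τ (embedding (C := C) R i) where
  additive := inferInstance
  linear := inferInstance
  map_mem h X Y f hf := by
    rw [embedding_map]
    refine inc_mem R (X := single i X) (Y := single i Y) ?_
    simpa using comp_mem (eqToHom_mem_homDeg (single_same i X))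
      (comp_mem hf (eqToHom_mem_homDeg (single_same i Y).symm))
  obj_degree g X hX m := by
    by_cases h : m = i
    · subst h
      change HasDegree R τ g ((single m X).obj m)
      rw [single_same]
      exact hX
    · exact ObjGrading.zero _ g (isZero_degOne.2 (isZero_single h X))

/-- Every object is the direct sum of its nonzero members. -/
def degOneSum (X : BoxSum C) : DegOneSum R H
    (fun i : X.finite.toFinset => single i.1 (X.obj i)) X where
  ι i := inc R (X := single i.1 (X.obj i)) (Y := X) i.1 (eqToHom (single_same _ _))
  π i := inc R (X := X) (Y := single i.1 (X.obj i)) i.1 (eqToHom (single_same _ _).symm)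
  ι_mem i := inc_mem R (eqToHom_mem_homDeg _)
  π_mem i := inc_mem R (eqToHom_mem_homDeg _)
  ι_π i := by
    rw [inc_comp_inc]
    refine Eq.trans ?_ ((embedding R i.1).map_id (X.obj i))
    rw [embedding_map]
    simp
  ι_π_ne i j hij := inc_comp_inc_of_ne R (fun h => hij (Subtype.ext h)) _ _
  total := by
    simp only [inc_comp_inc, eqToHom_trans, eqToHom_refl]
    refine Eq.trans ?_ (eq_sum_inc (R := R) (𝟙 X)).symm
    exact Finset.sum_coe_sort X.finite.toFinset fun i => inc R (X := X) (Y := X) i (𝟙 (X.obj i))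

-- Direct sums are formed componentwise. The result has finite support because a sum of zero objects
-- is zero, so its support lies in the union of the finitely many supports of the `Y j`.
omit [∀ i, HasZeroObject (C i)] in
lemma exists_degOneSum {J : Type*} [Fintype J]
    (hC : ∀ i (Y : J → C i), ∃ X, Nonempty (DegOneSum R H Y X)) (Y : J → BoxSum C) :
    ∃ X, Nonempty (DegOneSum R H Y X) := by
  choose X hX using fun i => hC i fun j => (Y j).obj i
  have d := fun i => (hX i).some
  refine ⟨⟨X, (Set.finite_iUnion fun j => (Y j).finite).subset fun i hi => ?_⟩,
    ⟨⟨fun j i => (d i).ι j, fun j i => (d i).π j, fun j i => (d i).ι_mem j,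
      fun j i => (d i).π_mem j, fun j => hom_ext fun i => (d i).ι_π j,
      fun j k h => hom_ext fun i => (d i).ι_π_ne j k h, hom_ext fun i => ?_⟩⟩⟩
  · by_contra h
    simp only [Set.mem_iUnion, not_exists] at h
    refine hi ((IsZero.iff_id_eq_zero _).2 ?_)
    rw [← (d i).total]
    refine Finset.sum_eq_zero fun j _ => ?_
    have : IsZero ((Y j).obj i) := by
      by_contra h'
      exact h j h'
    rw [this.eq_zero_of_tgt ((d i).π j), zero_comp]
  · rw [sum_apply]
    exact (d i).total

end BoxSum

/-- The direct sum of the completions of the `K i` is generated by the `K i`. -/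
lemma isGenerating_boxSum {R : Type uR} [CommRing R] {H : Type uH} [Group H] {G : Type uG}
    [Group G] {τ : H →* G} {I : Type w} {K : I → Type u} [∀ i, Category.{v} (K i)]
    [∀ i, Preadditive (K i)] [∀ i, Linear R (K i)] [∀ i, HomGraded R H (K i)]
    [∀ i, TauGraded R τ (K i)] :
    IsGenerating R τ fun i => Mat_.embedding (K i) ⋙
      BoxSum.embedding (C := fun i => Mat_ (K i)) R i where
  tau i := MatGrading.isTauFunctor_embedding.comp (BoxSum.isTauFunctor_embedding R i)
  full i := inferInstance
  faithful i := inferInstance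
  cross h _ _ f := BoxSum.embedding_cross R h f
  decomp X := by
    -- `IsGenerating` asks for index types in `Type`, while `I` lives in `Type w`; numbering the
    -- support by `Fin` settles this.
    let e := X.finite.toFinset.equivFin.symm
    refine ⟨Σ j, (X.obj (e j).1).ι, inferInstance, fun p => ⟨(e p.1).1, (X.obj (e p.1).1).X p.2⟩,
      ⟨?_⟩⟩
    exact ((BoxSum.degOneSum (H := H) R X).reindex e).sigma fun j =>
        (BoxSum.isTauFunctor_embedding (H := H) (τ := τ) (C := fun i => Mat_ (K i)) R (e j).1).mapSum
          (MatGrading.nonempty_degOneSum_embedding (X.obj (e j).1)).some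
  sums Y := BoxSum.exists_degOneSum R (fun _ Y => MatGrading.exists_degOneSum Y) Y

/-! ### Linear simple and semisimple categories -/

section LinearSimple

variable {R : Type uR} [CommRing R] {D : Type*} [Category* D] [Preadditive D] [Linear R D]

/-- A linear isomorphism gives some generator of the endomorphism module. Composing it with itself
shows that the identity is a unit multiple of that generator, hence itself a free generator. -/
lemma isLinearSimple_iff {X : D} : IsLinearSimple R X ↔
    (∀ f : X ⟶ X, ∃ r : R, f = r • 𝟙 X) ∧ ∀ r : R, r • 𝟙 X = 0 → r = 0 := by
  constructor
  · rintro ⟨e⟩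
    have hs : ∀ f : X ⟶ X, f = e f • e.symm 1 := fun f => e.injective (by simp)
    obtain ⟨s, hs₁⟩ : ∃ s : R, e.symm 1 ≫ e.symm 1 = s • e.symm 1 := ⟨_, hs _⟩
    have hid : e (𝟙 X) * s = 1 := by
      have h : e.symm 1 = (e (𝟙 X) * s) • e.symm 1 := by
        rw [mul_smul, ← hs₁, ← Linear.smul_comp, ← hs, Category.id_comp]
      simpa using (congrArg e h).symm
    refine ⟨fun f => ⟨e f * s, e.injective ?_⟩, fun r hr => ?_⟩
    · rw [map_smul, smul_eq_mul, mul_assoc, mul_comm s, hid, mul_one]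
    · have := congrArg e hr
      rw [map_smul, map_zero, smul_eq_mul] at this
      rw [← mul_one r, ← hid, ← mul_assoc, this, zero_mul]
  · rintro ⟨h₁, h₂⟩
    refine ⟨(LinearEquiv.ofBijective (LinearMap.toSpanSingleton R _ (𝟙 X)) ⟨?_, ?_⟩).symm⟩
    · rw [injective_iff_map_eq_zero]
      exact fun r hr => h₂ r (by simpa using hr)
    · intro f
      obtain ⟨r, hr⟩ := h₁ f
      exact ⟨r, by simpa using hr.symm⟩

lemma IsLinearSimple.not_isZero [Nontrivial R] {X : D} (hX : IsLinearSimple R X) : ¬ IsZero X :=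
  fun h => one_ne_zero ((isLinearSimple_iff.1 hX).2 (1 : R) (h.eq_of_src _ _))

/-- A retract of a linear simple object of a linear semisimple category is zero or everything. -/
lemma IsLinearSimple.retract (hD : IsLinearSemisimple R D) {T A : D} (hT : IsLinearSimple R T)
    {i : A ⟶ T} {p : T ⟶ A} (hip : i ≫ p = 𝟙 A) : IsZero A ∨ p ≫ i = 𝟙 T := by
  obtain ⟨-, S, hS, -, hdec⟩ := hD
  obtain ⟨n, Y, hY, ι, π, h₁, -, h₃⟩ := hdec A
  obtain ⟨r, hr⟩ := (isLinearSimple_iff.1 hT).1 (p ≫ i)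
  rcases n with _ | n
  · left
    rw [IsZero.iff_id_eq_zero, ← h₃]
    simp
  · right
    -- On the simple summand `Y 0` of `A`, the idempotent `p ≫ i = r • 𝟙` acts as the identity, and
    -- scalars act faithfully on `Y 0`. That `r` is idempotent would not suffice, since `R` may have
    -- nontrivial idempotents.
    have h : (r - 1) • 𝟙 (Y 0) = 0 := by
      have : (ι 0 ≫ i) ≫ (p ≫ i) ≫ (p ≫ π 0) = r • 𝟙 (Y 0) := by
        rw [hr]
        simp [reassoc_of% hip, h₁]
      rw [sub_smul, one_smul, ← this, sub_eq_zero]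
      simp [reassoc_of% hip, h₁]
    rw [hr, sub_eq_zero.1 ((isLinearSimple_iff.1 (hS _ (hY 0))).2 _ h), one_smul]

/-- A linear simple object is isomorphic to a summand of any direct sum decomposition. -/
lemma IsLinearSimple.exists_iso [Nontrivial R] (hD : IsLinearSemisimple R D) {T : D}
    (hT : IsLinearSimple R T) {J : Type*} [Fintype J] {Y : J → D} (h : IsDirectSum Y T) :
    ∃ j, Nonempty (T ≅ Y j) := by
  obtain ⟨ι, π, h₁, -, h₃⟩ := h
  -- Each summand is a retract of `T`; if none is all of `T`, all of them are zero and so is `T`.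
  by_contra hcon
  refine hT.not_isZero ((IsZero.iff_id_eq_zero T).2 ?_)
  rw [← h₃]
  refine Finset.sum_eq_zero fun j _ => ?_
  rcases hT.retract hD (h₁ j) with h | h
  · rw [h.eq_zero_of_tgt (π j), zero_comp]
  · exact absurd ⟨j, ⟨⟨π j, ι j, h, h₁ j⟩⟩⟩ hcon

lemma IsLinearSimple.nonempty_iso_of_ne_zero [Nontrivial R] (hD : IsLinearSemisimple R D)
    {T T' : D} (hT : IsLinearSimple R T) (hT' : IsLinearSimple R T') {f : T ⟶ T'} (hf : f ≠ 0) :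
    Nonempty (T ≅ T') := by
  have hD' := hD
  obtain ⟨-, S, -, hdisj, hdec⟩ := hD'
  obtain ⟨n, Y, hY, h⟩ := hdec T
  obtain ⟨n', Y', hY', h'⟩ := hdec T'
  obtain ⟨j, ⟨e⟩⟩ := hT.exists_iso hD h
  obtain ⟨j', ⟨e'⟩⟩ := hT'.exists_iso hD h'
  by_cases hne : Y j = Y' j'
  · exact ⟨e ≪≫ eqToIso hne ≪≫ e'.symm⟩
  · refine absurd ?_ hf
    have := hdisj _ (hY j) _ (hY' j') hne (e.inv ≫ f ≫ e'.hom)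
    simpa using this

lemma IsLinearSimple.exists_mem [Nontrivial R] (hD : IsLinearSemisimple R D) {T : D}
    (hT : IsLinearSimple R T) {G : Type uG} (Γ : ObjGrading G D) : ∃ g, Γ.mem g T := by
  obtain ⟨s, Y, hY, h⟩ := Γ.decomp T
  obtain ⟨g, ⟨e⟩⟩ := hT.exists_iso hD h
  exact ⟨g, Γ.closed e.symm (hY g)⟩

end LinearSimple

/-! ### Simple objects and shifts -/

section Shifts

variable {R : Type uR} [CommRing R] {H : Type uH} [Group H] {C : Type u} [Category.{v} C]
  [Preadditive C] [Linear R C] [HomGraded R H C]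

lemma isSimple_iff {X : C} : IsSimple R H X ↔
    (∀ f ∈ homDeg R (1 : H) X X, ∃ r : R, f = r • 𝟙 X) ∧ ∀ r : R, r • 𝟙 X = 0 → r = 0 := by
  refine isLinearSimple_iff.trans ⟨fun h => ⟨fun f hf => ?_, fun r hr => ?_⟩,
    fun h => ⟨fun f => ?_, fun r hr => ?_⟩⟩
  · obtain ⟨r, hr⟩ := h.1 (DegOne.mk' f hf)
    exact ⟨r, congrArg DegOne.val hr⟩
  · exact h.2 r (DegOne.hom_ext hr)
  · obtain ⟨r, hr⟩ := h.1 (DegOne.val f) (DegOne.val_mem f)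
    exact ⟨r, DegOne.hom_ext hr⟩
  · exact h.2 r (congrArg DegOne.val hr)

lemma IsSimple.id_ne_zero [Nontrivial R] {X : C} (hX : IsSimple R H X) : 𝟙 X ≠ 0 := fun h =>
  one_ne_zero ((isSimple_iff.1 hX).2 (1 : R) (by rw [h, smul_zero]))

/-- Conjugation by an isomorphism of degree `a` identifies the degree 1 endomorphisms of `X` and
`Y`: a conjugate has degree `a * 1 * a⁻¹ = 1`. -/
lemma IsSimple.of_isShift {X Y : C} (hX : IsSimple R H X) {a : H} (h : IsShift R a X Y) :
    IsSimple R H Y := by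
  obtain ⟨r, h₁, h₂⟩ := h
  rw [isSimple_iff] at hX ⊢
  refine ⟨fun f hf => ?_, fun c hc => ?_⟩
  · obtain ⟨c, hc⟩ := hX.1 (r.hom ≫ f ≫ r.inv) (by simpa using comp_mem h₁ (comp_mem hf h₂))
    refine ⟨c, ?_⟩
    have := congrArg (fun k => r.inv ≫ k ≫ r.hom) hc
    simpa using this
  · refine hX.2 c ?_
    have := congrArg (fun k => r.hom ≫ k ≫ r.inv) hc
    simpa using this

/-- The morphisms of degree `a` out of a simple object are spanned by any isomorphism. -/
lemma IsSimple.exists_eq_smul {X Y : C} (hX : IsSimple R H X) {a : H} {r : X ≅ Y}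
    (hr : r.inv ∈ homDeg R a⁻¹ Y X) {f : X ⟶ Y} (hf : f ∈ homDeg R a X Y) :
    ∃ c : R, f = c • r.hom := by
  obtain ⟨c, hc⟩ := (isSimple_iff.1 hX).1 (f ≫ r.inv) (by simpa using comp_mem hf hr)
  refine ⟨c, ?_⟩
  have := congrArg (fun k => k ≫ r.hom) hc
  simpa using this

lemma IsSimple.eq_zero_of_smul {X Y : C} (hX : IsSimple R H X) {r : X ≅ Y} {c : R}
    (hc : c • r.hom = 0) : c = 0 := by
  refine (isSimple_iff.1 hX).2 c ?_
  have := congrArg (fun k => k ≫ r.inv) hc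
  simpa using this

lemma IsSimple.smul_injective {X Y : C} (hX : IsSimple R H X) {r : X ≅ Y} {c c' : R}
    (h : c • r.hom = c' • r.hom) : c = c' :=
  sub_eq_zero.1 (hX.eq_zero_of_smul (r := r) (by rw [sub_smul, h, sub_self]))

/-- Each of `r` and `s` is a multiple of the other, and scalars act faithfully, so the two factors
are mutually inverse. -/
lemma IsSimple.exists_unit {X Y : C} (hX : IsSimple R H X) {a : H} {r s : X ≅ Y}
    (hr : r.hom ∈ homDeg R a X Y) (hr' : r.inv ∈ homDeg R a⁻¹ Y X)
    (hs : s.hom ∈ homDeg R a X Y) (hs' : s.inv ∈ homDeg R a⁻¹ Y X) :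
    ∃ c : Rˣ, r.hom = (c : R) • s.hom := by
  obtain ⟨c, hc⟩ := hX.exists_eq_smul hs' hr
  obtain ⟨d, hd⟩ := hX.exists_eq_smul hr' hs
  have hcd : c * d = 1 := by
    refine hX.smul_injective (r := r) ?_
    rw [mul_smul, ← hd, ← hc, one_smul]
  exact ⟨⟨c, d, hcd, by rw [mul_comm, hcd]⟩, hc⟩

/-- Replacing `X` by its shift by `a` turns `f` into a nonzero morphism of degree 1 between simple
objects, which are then isomorphic in `C¹`. This is the graded form of Schur's lemma. -/
lemma IsSemisimple.isShift_of_ne_zero [Nontrivial R] (hC : IsSemisimple R H C) {X Y : C}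
    (hX : IsSimple R H X) (hY : IsSimple R H Y) {a : H} {f : X ⟶ Y} (hf : f ∈ homDeg R a X Y)
    (hf₀ : f ≠ 0) : IsShift R a X Y := by
  obtain ⟨Z, hZ⟩ := hC.1 X a
  have hZ' := hX.of_isShift hZ
  have hXZ := hZ
  obtain ⟨r, h₁, h₂⟩ := hZ
  have hk : r.inv ≫ f ∈ homDeg R (1 : H) Z Y := by simpa using comp_mem h₂ hf
  have hk₀ : (DegOne.mk' (X := ⟨Z⟩) (Y := ⟨Y⟩) (r.inv ≫ f) hk) ≠ 0 := by
    intro h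
    have := congrArg (fun k => r.hom ≫ DegOne.val k) h
    exact hf₀ (by simpa using this)
  obtain ⟨e⟩ := IsLinearSimple.nonempty_iso_of_ne_zero hC.2 hZ' hY hk₀
  simpa using hXZ.trans (isShift_one_of_iso e)

lemma eq_zero_of_forall_homDeg {X Y : C} (h : ∀ a : H, ∀ f ∈ homDeg R a X Y, f = 0) (f : X ⟶ Y) :
    f = 0 := by
  have : (⊤ : Submodule R (X ⟶ Y)) ≤ ⊥ := by
    rw [← HomGraded.iSup_eq_top (R := R) (H := H) X Y]
    exact iSup_le fun a k hk => h a k hk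
  exact this trivial

-- The isomorphism `T ≅ S` of degree 1 in the definition of `L_S` can be absorbed into the shift.
variable (H) in
lemma mem_shiftStab_iff {S : C} {a : H} : a ∈ shiftStab R S ↔ IsShift R a S S := by
  constructor
  · rintro ⟨T, h, ⟨e⟩⟩
    simpa using h.trans (isShift_one_of_iso e)
  · exact fun h => ⟨S, h, ⟨Iso.refl _⟩⟩

/-! ### Degrees of simple objects and of their shifts -/

section Degrees

variable {G : Type uG} [Group G] {τ : H →* G} [TauGraded R τ C]

lemma IsSemisimple.exists_hasDegree [Nontrivial R] (hC : IsSemisimple R H C) {S : C}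
    (hS : IsSimple R H S) : ∃ g, HasDegree R τ g S :=
  IsLinearSimple.exists_mem hC.2 hS _

lemma HasDegree.eq_mul {g g' : G} {X Y : C} (hX : HasDegree R τ g X) (hY : HasDegree R τ g' Y)
    {a : H} {f : X ⟶ Y} (hf : f ∈ homDeg R a X Y) (hf₀ : f ≠ 0) : g' = τ a * g := by
  by_contra h
  rw [TauGraded.homDeg_eq_bot (τ := τ) hX hY a h] at hf
  exact hf₀ hf

lemma IsShift.eq_mul [Nontrivial R] {g g' : G} {X Y : C} (hS : IsSimple R H X)
    (hX : HasDegree R τ g X) (hY : HasDegree R τ g' Y) {a : H} (h : IsShift R a X Y) :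
    g' = τ a * g := by
  obtain ⟨r, h₁, -⟩ := h
  refine hX.eq_mul hY h₁ fun h => hS.id_ne_zero ?_
  rw [← r.hom_inv_id, h, zero_comp]

end Degrees

lemma hasFiniteBiproducts_degOne
    (h : ∀ (n : ℕ) (Y : Fin n → C), ∃ X, Nonempty (DegOneSum R H Y X)) :
    HasFiniteBiproducts (DegOne R H C) := by
  refine ⟨fun n => ⟨fun Y => ?_⟩⟩
  obtain ⟨X, hX⟩ := h n fun j => (Y j).obj
  obtain ⟨ι, π, h₁, h₂, h₃⟩ := (nonempty_degOneSum_iff (Y := Y) (X := ⟨X⟩)).1 hX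
  refine hasBiproduct_of_total
    { pt := ⟨X⟩, ι := ι, π := π, ι_π := fun j k => ?_ } h₃
  split_ifs with hjk
  · subst hjk
    simpa using h₁ j
  · exact h₂ j k hjk

lemma exists_degOneSum_of_hasFiniteBiproducts [HasFiniteBiproducts (DegOne R H C)] {J : Type}
    [Fintype J] (Y : J → C) : ∃ X, Nonempty (DegOneSum R H Y X) := by
  classical
  let Y' : J → DegOne R H C := fun j => ⟨Y j⟩
  refine ⟨(⨁ Y').obj, (nonempty_degOneSum_iff (Y := Y')).2
    ⟨biproduct.ι Y', biproduct.π Y', fun j => by simp, fun j k h => ?_, biproduct.total⟩⟩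
  exact biproduct.ι_π_ne Y' h

end Shifts

/-! ### The categories `S_τ(L, ψ)⟨g⟩` -/

namespace SCat

variable {H : Type uH} [Group H] {G : Type uG} [Group G] {τ : H →* G} {R : Type uR}
  [CommRing R] {L : Subgroup H} {hL : L ≤ τ.ker} {ψ : NormCocycle R L} {g : G}

lemma e_mem (a : H) {X Y : SCat τ R L hL ψ g} (h : a • X.coset = Y.coset) :
    e a h ∈ homDeg R a X Y :=
  Finsupp.single_mem_supported (M := R) R (1 : R) rfl

lemma exists_eq_smul_e {a : H} {X Y : SCat τ R L hL ψ g} (h : a • X.coset = Y.coset)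
    {f : X ⟶ Y} (hf : f ∈ homDeg R a X Y) : ∃ r : R, f = r • e a h := by
  have hf' : (f : SHom X Y) ∈
      (Finsupp.supported R R {p | p.1 = a} : Submodule R (SHom X Y)) := hf
  have hs : ({p | p.1 = a} : Set {a : H // a • X.coset = Y.coset}) = {⟨a, h⟩} := by
    ext p
    simp [Subtype.ext_iff]
  rw [hs, Finsupp.supported_eq_span_single, Set.image_singleton,
    Submodule.mem_span_singleton] at hf'
  obtain ⟨r, hr⟩ := hf'
  exact ⟨r, hr.symm⟩

lemma eq_zero_of_smul_e {a : H} {X Y : SCat τ R L hL ψ g} (h : a • X.coset = Y.coset) {r : R}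
    (hr : r • e a h = 0) : r = 0 := by
  have h₁ : r • (Finsupp.single ⟨a, h⟩ 1 : SHom X Y) = 0 := hr
  simpa using h₁

lemma isSimple (X : SCat τ R L hL ψ g) : IsSimple R H X :=
  isSimple_iff.2 ⟨fun _ hf => exists_eq_smul_e (one_smul _ _) hf,
    fun _ hr => eq_zero_of_smul_e (one_smul _ _) hr⟩

/-- The inverse of `e^a` is `e^{a⁻¹}` scaled by `ψ(a⁻¹,a)(x)`. As a one-sided inverse this is
immediate from the composition law; the other side needs `ψ(a⁻¹,a)(x) = ψ(a,a⁻¹)(ax)`, the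
normalised cocycle identity for the triple `a, a⁻¹, a`. -/
lemma isShift (X : SCat τ R L hL ψ g) (a : H) : IsShift R a X ⟨a • X.coset⟩ := by
  let Y : SCat τ R L hL ψ g := ⟨a • X.coset⟩
  have h : a⁻¹ • Y.coset = X.coset := inv_smul_smul a _
  have hψ : ψ.toFun a⁻¹ a X.coset = ψ.toFun a a⁻¹ Y.coset := by
    have := ψ.mul_eq a a⁻¹ a X.coset
    rw [inv_mul_cancel, mul_inv_cancel, ψ.one_right, ψ.one_left, mul_one, mul_one] at this
    exact this
  have he : ∀ (Z : SCat τ R L hL ψ g) (b : H) (hb : b • Z.coset = Z.coset), b = 1 →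
      e b hb = 𝟙 Z := by
    rintro Z _ hb rfl
    rfl
  refine ⟨⟨e a (Y := Y) rfl, (ψ.toFun a⁻¹ a X.coset : R) • e a⁻¹ h, ?_, ?_⟩, e_mem a rfl,
    Submodule.smul_mem _ _ (e_mem _ h)⟩
  · rw [Linear.comp_smul, e_comp_e (hab := by rw [mul_smul]; exact h), smul_smul, Units.mul_inv,
      one_smul, he _ _ _ (inv_mul_cancel a)]
  · rw [Linear.smul_comp, e_comp_e (hab := by rw [mul_smul, h]), smul_smul, hψ, Units.mul_inv,
      one_smul, he _ _ _ (mul_inv_cancel a)]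

end SCat

lemma IsTauFunctor.isSimple {R : Type uR} [CommRing R] {H : Type uH} [Group H] {G : Type uG}
    [Group G] {τ : H →* G} {C : Type u} [Category.{v} C] [Preadditive C] [Linear R C]
    [HomGraded R H C] [TauGraded R τ C] {D : Type*} [Category* D] [Preadditive D] [Linear R D]
    [HomGraded R H D] [TauGraded R τ D] {F : C ⥤ D} (hF : IsTauFunctor R τ F) [F.Full]
    [F.Faithful] {X : C} (hX : IsSimple R H X) : IsSimple R H (F.obj X) := by
  have := hF.additive
  have := hF.linear
  rw [isSimple_iff] at hX ⊢
  refine ⟨fun f hf => ?_, fun r hr => hX.2 r (F.map_injective ?_)⟩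
  · obtain ⟨f, rfl⟩ := F.map_surjective f
    obtain ⟨r, rfl⟩ := hX.1 f (hF.mem_of_map_mem hf)
    exact ⟨r, by simp⟩
  · simpa using hr

/-! ### Categories generated by the `S_τ(L, ψ)⟨g⟩` are semisimple -/

section Generating

variable {R : Type uR} [CommRing R] [Nontrivial R] {H : Type uH} [Group H] {G : Type uG} [Group G]
  {τ : H →* G} {I : Type w} {L : I → Subgroup H} {hL : ∀ i, L i ≤ τ.ker}
  {ψ : ∀ i, NormCocycle R (L i)} {g : I → G}
  {C : Type u} [Category.{v} C] [Preadditive C] [Linear R C] [HomGraded R H C] [TauGraded R τ C]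

lemma IsGenerating.isSemisimple {P : ∀ i, SCat τ R (L i) (hL i) (ψ i) (g i) ⥤ C}
    (hP : IsGenerating R τ P) : IsSemisimple R H C := by
  have hf := hP.full
  have hf' := hP.faithful
  refine ⟨fun X a => ?_, hasFiniteBiproducts_degOne fun n Y => hP.sums Y,
    -- All images of the `R_x` can be taken: a nonzero degree 1 morphism `R_x → R_y` forces `x = y`,
    -- so different members are already disjoint.
    {X | ∃ i x, X.obj = (P i).obj x}, ?_, ?_, fun X => ?_⟩
  · obtain ⟨J, _, k, ⟨d⟩⟩ := hP.decomp X
    obtain ⟨Y, ⟨d'⟩⟩ := hP.sums fun j => (P (k j).1).obj ⟨a • (k j).2.coset⟩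
    exact ⟨Y, d.isShift d' a fun j => (hP.tau _).isShift (SCat.isShift _ a)⟩
  · rintro ⟨X⟩ ⟨i, x, rfl⟩
    exact (hP.tau i).isSimple (SCat.isSimple x)
  · rintro ⟨X⟩ ⟨i, x, rfl⟩ ⟨Y⟩ ⟨j, y, rfl⟩ hne f
    refine DegOne.hom_ext ?_
    by_cases hij : i = j
    · subst hij
      by_contra hf₀
      obtain ⟨k, hk⟩ := (P i).map_surjective (DegOne.val f)
      have hk₁ : k ∈ homDeg R (1 : H) x y :=
        (hP.tau i).mem_of_map_mem (by rw [hk]; exact DegOne.val_mem f)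
      have := (hP.tau i).additive
      have hxy := SCat.coset_eq k hk₁ (by
        rintro rfl
        exact hf₀ (by rw [← hk, Functor.map_zero]; rfl))
      rw [one_smul] at hxy
      exact hne (by rw [SCat.ext hxy])
    · exact hP.cross hij _
  · obtain ⟨J, _, k, ⟨d⟩⟩ := hP.decomp X.obj
    let ε := (Fintype.equivFin J).symm
    exact ⟨_, fun j => ⟨(P (k (ε j)).1).obj (k (ε j)).2⟩, fun j => ⟨_, _, rfl⟩,
      nonempty_degOneSum_iff.1 ⟨d.reindex ε⟩⟩

end Generating

/-! ### Frames of shifts -/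

section Frames

variable {R : Type uR} [CommRing R] {H : Type uH} [Group H]
  {C : Type u} [Category.{v} C] [Preadditive C] [Linear R C] [HomGraded R H C] {S : C}

/-- Going from `S` to `X`, along a shift by `a` to `Y`, and back to `S` is a shift of `S` onto
itself by `c⁻¹ab`, which exists exactly when `c⁻¹ab ∈ L_S`. Thus shifting acts on the shifts of `S`
as `H` acts on `H/L_S`. -/
lemma isShift_iff_smul_eq {x y : H ⧸ shiftStab R (H := H) S} {b c : H}
    (hb : (QuotientGroup.mk b : H ⧸ shiftStab R (H := H) S) = x)
    (hc : (QuotientGroup.mk c : H ⧸ shiftStab R (H := H) S) = y) {X Y : C}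
    (hX : IsShift R b S X) (hY : IsShift R c S Y) (a : H) :
    IsShift R a X Y ↔ a • x = y := by
  have h₁ : a • x = y ↔ c⁻¹ * (a * b) ∈ shiftStab R (H := H) S := by
    rw [← hb, ← hc, ← QuotientGroup.eq, MulAction.Quotient.smul_mk, smul_eq_mul, eq_comm]
  rw [h₁, mem_shiftStab_iff]
  refine ⟨fun h => (hX.trans h).trans hY.symm, fun h => ?_⟩
  have := (hX.symm.trans h).trans hY
  simpa [mul_assoc] using this

lemma exists_shiftFrame (hC : IsSemisimple R H C) (hS : IsSimple R H S) :
    Nonempty (ShiftFrame R H S) := by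
  classical
  choose sh hsh using fun x : H ⧸ shiftStab R (H := H) S => hC.1 S (Quotient.out x)
  have hmk : ∀ x : H ⧸ shiftStab R (H := H) S, QuotientGroup.mk (Quotient.out x) = x :=
    QuotientGroup.out_eq'
  have key : ∀ (a : H) (x y : H ⧸ shiftStab R (H := H) S) (_ : a • x = y),
      ∃ f : sh x ⟶ sh y, Submodule.span R {f} = homDeg R a (sh x) (sh y) ∧
        -- This clause is carried through the choice so that the chosen family satisfies `f^1_x =
        -- id`.
        ∀ (_ : a = 1) (h : x = y), f = eqToHom (congrArg sh h) := by
    intro a x y h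
    obtain ⟨r, hr, hr'⟩ : ∃ r : sh x ≅ sh y, (r.hom ∈ homDeg R a (sh x) (sh y) ∧
        r.inv ∈ homDeg R a⁻¹ (sh y) (sh x)) ∧
          ∀ (_ : a = 1) (h : x = y), r.hom = eqToHom (congrArg sh h) := by
      by_cases ha : a = 1
      · subst ha
        obtain rfl : x = y := by rw [← h, one_smul]
        exact ⟨Iso.refl _, ⟨id_mem _, by simpa using id_mem (R := R) (H := H) (sh x)⟩,
          fun _ _ => rfl⟩
      · obtain ⟨r, hr⟩ := (isShift_iff_smul_eq (hmk x) (hmk y) (hsh x) (hsh y) a).2 h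
        exact ⟨r, hr, fun h => absurd h ha⟩
    refine ⟨r.hom, le_antisymm ?_ fun k hk => ?_, hr'⟩
    · rw [Submodule.span_singleton_le_iff_mem]
      exact hr.1
    · obtain ⟨c, rfl⟩ := (hS.of_isShift (hsh x)).exists_eq_smul hr.2 hk
      exact Submodule.smul_mem _ _ (Submodule.mem_span_singleton_self _)
  choose f hf hf₁ using key
  exact ⟨⟨_, hmk, sh, hsh, fun a {x y} h => f a x y h, fun a {x y} h => hf a x y h,
    fun x => hf₁ 1 x x _ rfl rfl⟩⟩

namespace ShiftFrame

lemma isSimple_shift (F : ShiftFrame R H S) (hS : IsSimple R H S)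
    (x : H ⧸ shiftStab R (H := H) S) : IsSimple R H (F.shift x) :=
  hS.of_isShift (F.isShift x)

lemma isShift_iff (F : ShiftFrame R H S) {a : H} {x y : H ⧸ shiftStab R (H := H) S} :
    IsShift R a (F.shift x) (F.shift y) ↔ a • x = y :=
  isShift_iff_smul_eq (F.rep_mk x) (F.rep_mk y) (F.isShift x) (F.isShift y) a

lemma f_mem (F : ShiftFrame R H S) (a : H) {x y : H ⧸ shiftStab R (H := H) S} (h : a • x = y) :
    F.f a h ∈ homDeg R a (F.shift x) (F.shift y) := by
  rw [← F.span_f a h]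
  exact Submodule.mem_span_singleton_self _

/-- The spanning morphisms of a frame are isomorphisms. -/
lemma exists_iso (F : ShiftFrame R H S) (hS : IsSimple R H S) (a : H)
    {x y : H ⧸ shiftStab R (H := H) S} (h : a • x = y) :
    ∃ r : F.shift x ≅ F.shift y, r.hom = F.f a h ∧
      r.inv ∈ homDeg R a⁻¹ (F.shift y) (F.shift x) := by
  have hS' := F.isSimple_shift hS x
  obtain ⟨s, hs, hs'⟩ := F.isShift_iff.2 h
  obtain ⟨c, hc⟩ := hS'.exists_eq_smul hs' (F.f_mem a h)
  rw [← F.span_f a h, Submodule.mem_span_singleton] at hs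
  obtain ⟨d, hd⟩ := hs
  -- `f^a` is a multiple of the isomorphism `s`, and `s` a multiple of the spanning `f^a`; the
  -- scalars are therefore inverse units.
  have hdc : d * c = 1 := hS'.smul_injective (r := s) (by rw [mul_smul, ← hc, hd, one_smul])
  refine ⟨⟨F.f a h, d • s.inv, ?_, ?_⟩, rfl, Submodule.smul_mem _ _ hs'⟩
  · rw [hc, Linear.smul_comp, Linear.comp_smul, smul_smul, mul_comm, hdc, one_smul, s.hom_inv_id]
  · rw [hc, Linear.smul_comp, Linear.comp_smul, smul_smul, hdc, one_smul, s.inv_hom_id]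

lemma smul_f_injective (F : ShiftFrame R H S) (hS : IsSimple R H S) {a : H}
    {x y : H ⧸ shiftStab R (H := H) S} {h : a • x = y} {c c' : R}
    (hc : c • F.f a h = c' • F.f a h) : c = c' := by
  obtain ⟨r, hr, -⟩ := F.exists_iso hS a h
  rw [← hr] at hc
  exact (F.isSimple_shift hS x).smul_injective hc

lemma f_congr (F : ShiftFrame R H S) {a a' : H} (ha : a = a') {x y : H ⧸ shiftStab R (H := H) S}
    (h : a • x = y) (h' : a' • x = y) : F.f a h = F.f a' h' := by
  subst ha; rfl

/-- Every frame of shifts of a simple object determines a unique cocycle. -/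
lemma existsUnique_isCocycle (F : ShiftFrame R H S) (hS : IsSimple R H S) :
    ∃! ψ : NormCocycle R (shiftStab R (H := H) S), F.IsCocycle ψ := by
  have hex : ∀ (a b : H) (x : H ⧸ shiftStab R (H := H) S), ∃ c : Rˣ,
      F.f (a * b) (mul_smul a b x) = (c : R) • (F.f b rfl ≫ F.f a rfl) := by
    intro a b x
    obtain ⟨r, hr, hr'⟩ := F.exists_iso hS (a * b) (mul_smul a b x)
    obtain ⟨s, hs, hs'⟩ := F.exists_iso hS b (rfl : b • x = b • x)
    obtain ⟨t, ht, ht'⟩ := F.exists_iso hS a (rfl : a • b • x = a • b • x)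
    rw [← hr, ← hs, ← ht]
    refine (F.isSimple_shift hS x).exists_unit (s := s ≪≫ t) (a := a * b) ?_ hr' ?_ ?_
    · rw [hr]
      exact F.f_mem _ _
    · rw [Iso.trans_hom, hs, ht]
      exact comp_mem (F.f_mem _ _) (F.f_mem _ _)
    · rw [mul_inv_rev]
      exact comp_mem ht' hs'
  have hinj : ∀ (a b : H) (x : H ⧸ shiftStab R (H := H) S) {c c' : R},
      c • (F.f b (rfl : b • x = b • x) ≫ F.f a (rfl : a • b • x = a • b • x)) =
        c' • (F.f b rfl ≫ F.f a rfl) → c = c' := by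
    intro a b x c c' h
    obtain ⟨s, hs, -⟩ := F.exists_iso hS b (rfl : b • x = b • x)
    obtain ⟨t, ht, -⟩ := F.exists_iso hS a (rfl : a • b • x = a • b • x)
    rw [← hs, ← ht, ← Iso.trans_hom] at h
    exact (F.isSimple_shift hS x).smul_injective h
  choose ψ hψ using hex
  have hψ' : ∀ (a b : H) {x y z : H ⧸ shiftStab R (H := H) S} (hxy : b • x = y)
      (hyz : a • y = z) (hxz : (a * b) • x = z),
      F.f (a * b) hxz = (ψ a b x : R) • (F.f b hxy ≫ F.f a hyz) := by
    intro a b x y z hxy hyz hxz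
    subst hxy hyz
    exact hψ a b x
  have hone : ∀ {x y : H ⧸ shiftStab R (H := H) S} (h : (1 : H) • x = y) (h' : x = y),
      F.f 1 h = eqToHom (congrArg F.shift h') := by
    rintro x _ h rfl
    exact F.f_one x
  refine ⟨⟨ψ, ?_, ?_, ?_⟩, fun a b => hψ' a b, ?_⟩
  · intro a b c x
    -- Expand `f^{abc}_x` in both bracketings; each is a scalar times `f^a ∘ f^b ∘ f^c`. This
    -- composite is an isomorphism out of a simple object, so the scalars agree.
    have h₁ := hψ' b c (x := x) rfl rfl (mul_smul _ _ _)
    have h₂ := hψ' a (b * c) (x := x) (mul_smul b c x) rfl (by simp only [mul_smul])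
    have h₃ := hψ' a b (x := c • x) rfl rfl (mul_smul _ _ _)
    have h₄ := hψ' (a * b) c (x := x) rfl (mul_smul a b (c • x)) (by simp only [mul_smul])
    have h₅ := F.f_congr (mul_assoc a b c) (x := x) (y := a • b • c • x)
      (by simp only [mul_smul]) (by simp only [mul_smul])
    rw [h₂, h₄, h₁, h₃] at h₅
    simp only [Linear.smul_comp, Linear.comp_smul, smul_smul, Category.assoc] at h₅
    have key : ψ (a * b) c x * ψ a b (c • x) = ψ a (b * c) x * ψ b c x := by
      obtain ⟨r, hr, -⟩ := F.exists_iso hS c (rfl : c • x = c • x)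
      obtain ⟨s, hs, -⟩ := F.exists_iso hS b (rfl : b • c • x = b • c • x)
      obtain ⟨t, ht, -⟩ := F.exists_iso hS a (rfl : a • b • c • x = a • b • c • x)
      rw [← hr, ← hs, ← ht, ← Iso.trans_hom, ← Iso.trans_hom] at h₅
      exact Units.ext (by simpa using (F.isSimple_shift hS x).smul_injective h₅)
    rw [mul_inv_eq_one, mul_right_comm, mul_inv_eq_iff_eq_mul, mul_comm (ψ b c x), ← key, mul_comm]
  · intro a x
    refine Units.ext (F.smul_f_injective hS (h := (rfl : a • x = a • x)) ?_)
    -- Since `f^1 = id`, the defining relation reads `f^a = ψ(1,a)(x) f^a`, and the scalar can be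
    -- compared with 1.
    have h := hψ' 1 a (x := x) rfl (one_smul H (a • x)) (by rw [one_mul])
    rw [F.f_one, Category.comp_id, F.f_congr (one_mul a) _ rfl] at h
    simpa using h.symm
  · intro a x
    refine Units.ext (F.smul_f_injective hS (h := (rfl : a • x = a • x)) ?_)
    have h := hψ' a 1 (x := x) (one_smul H x) rfl (by rw [mul_one])
    rw [F.f_one, Category.id_comp, F.f_congr (mul_one a) _ rfl] at h
    simpa using h.symm
  · rintro ⟨ψ', h₁, h₂, h₃⟩ h
    have : ψ' = ψ := by
      funext a b x
      refine Units.ext (hinj a b x ?_)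
      rw [← hψ a b x]
      exact (h a b rfl rfl _).symm
    subst this
    rfl

end ShiftFrame

end Frames

/-! ### The functor from `S_τ(L_S, ψ_S)⟨g⟩` to `C` and the classification -/

section FrameFunctor

variable {R : Type uR} [CommRing R] {H : Type uH} [Group H] {G : Type uG} [Group G] {τ : H →* G}
  {C : Type u} [Category.{v} C] [Preadditive C] [Linear R C] [HomGraded R H C] {S : C}

namespace ShiftFrame

variable (F : ShiftFrame R H S) {hL : shiftStab R (H := H) S ≤ τ.ker}
  {ψ : NormCocycle R (shiftStab R (H := H) S)} {g : G}

/-- The linear map sending `e^a_x` to `f^a_x`. -/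
def mapHom (X Y : SCat τ R (shiftStab R (H := H) S) hL ψ g) :
    SCat.SHom X Y →ₗ[R] (F.shift X.coset ⟶ F.shift Y.coset) :=
  Finsupp.linearCombination R fun a : {a : H // a • X.coset = Y.coset} => F.f a.1 a.2

lemma mapHom_single {X Y : SCat τ R (shiftStab R (H := H) S) hL ψ g}
    (a : {a : H // a • X.coset = Y.coset}) (r : R) :
    F.mapHom X Y (Finsupp.single a r) = r • F.f a.1 a.2 :=
  Finsupp.linearCombination_single _ _ _

variable {F}

/-- On generators, the factor `ψ(a,b)(x)⁻¹` in the composition law of `SCat` cancels the factor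
`ψ(a,b)(x)` defining the cocycle of the frame. -/
lemma IsCocycle.mapHom_comp (hψ : F.IsCocycle ψ)
    {X Y Z : SCat τ R (shiftStab R (H := H) S) hL ψ g} (p : SCat.SHom X Y) (q : SCat.SHom Y Z) :
    F.mapHom X Z (SCat.compHom X Y Z p q) = F.mapHom X Y p ≫ F.mapHom Y Z q := by
  induction p using Finsupp.induction_linear with
  | zero => simp
  | add p p' h h' => simp only [map_add, LinearMap.add_apply, h, h', Preadditive.add_comp]
  | single b r =>
    induction q using Finsupp.induction_linear with
    | zero => simp
    | add q q' h h' => simp only [map_add, h, h', Preadditive.comp_add]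
    | single a s =>
      rw [SCat.compHom_single, mapHom_single, mapHom_single, mapHom_single,
        hψ a.1 b.1 b.2 a.2, smul_smul, mul_assoc, Units.inv_mul, mul_one, Linear.smul_comp,
        Linear.comp_smul, smul_smul]

/-- The functor `S_τ(L_S, ψ_S)⟨g⟩ ⥤ C` which sends `R_x` to `S⟨h_x⟩` and `e^a_x` to `f^a_x`. -/
def functor (hψ : F.IsCocycle ψ) : SCat τ R (shiftStab R (H := H) S) hL ψ g ⥤ C where
  obj X := F.shift X.coset
  map {X Y} p := F.mapHom X Y p
  map_id X := by
    refine (F.mapHom_single ⟨1, one_smul H X.coset⟩ 1).trans ?_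
    rw [F.f_one, one_smul]
  map_comp p q := hψ.mapHom_comp p q

variable (F)

/-- The `f^a` lie in different degrees, so their spans are independent, and each is torsion-free. -/
lemma mapHom_injective (hS : IsSimple R H S)
    (X Y : SCat τ R (shiftStab R (H := H) S) hL ψ g) : Function.Injective (F.mapHom X Y) := by
  have h₁ : iSupIndep fun a : {a : H // a • X.coset = Y.coset} =>
      Submodule.span R {F.f a.1 a.2} := by
    simp only [F.span_f]
    exact (HomGraded.indep (R := R) (H := H) _ _).comp Subtype.val_injective
  refine Ideal.iSupIndep.linearIndependent' h₁ fun a => ?_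
  rw [eq_bot_iff]
  intro r hr
  rw [Ideal.mem_torsionOf_iff] at hr
  exact F.smul_f_injective hS (h := a.2) (by rw [hr, zero_smul])

/-- It suffices to reach each degree `a`. If `a` carries one coset to the other, `f^a` spans;
otherwise a nonzero morphism of degree `a` would exhibit a shift that `isShift_iff` excludes. -/
lemma mapHom_surjective [Nontrivial R] (hC : IsSemisimple R H C) (hS : IsSimple R H S)
    (X Y : SCat τ R (shiftStab R (H := H) S) hL ψ g) : Function.Surjective (F.mapHom X Y) := by
  rw [← LinearMap.range_eq_top, eq_top_iff,
    ← HomGraded.iSup_eq_top (R := R) (H := H) (F.shift X.coset) (F.shift Y.coset)]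
  refine iSup_le fun a => ?_
  by_cases h : a • X.coset = Y.coset
  · refine (F.span_f a h).symm.le.trans ?_
    rw [Submodule.span_singleton_le_iff_mem]
    exact ⟨Finsupp.single ⟨a, h⟩ 1, by rw [mapHom_single, one_smul]⟩
  · intro k hk
    have : k = 0 := by
      by_contra hk₀
      exact h (F.isShift_iff.1 (hC.isShift_of_ne_zero (F.isSimple_shift hS _)
        (F.isSimple_shift hS _) hk hk₀))
    rw [this]
    exact Submodule.zero_mem _

variable [Nontrivial R] [TauGraded R τ C]

/-- The shifted object is simple, hence homogeneous of some degree, and the degree 1-to-`h_x`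
isomorphism from `S` forces it to be `τ(h_x) g`. -/
lemma hasDegree_shift (hC : IsSemisimple R H C) (hS : IsSimple R H S) (hg : HasDegree R τ g S)
    (X : SCat τ R (shiftStab R (H := H) S) hL ψ g) : HasDegree R τ X.deg (F.shift X.coset) := by
  obtain ⟨d, hd⟩ := hC.exists_hasDegree (τ := τ) (F.isSimple_shift hS X.coset)
  have h := (F.isShift X.coset).eq_mul hS hg hd
  have hX : X.deg = τ (F.rep X.coset) * g := by
    conv_lhs => rw [show X = ⟨QuotientGroup.mk (F.rep X.coset)⟩ from SCat.ext (F.rep_mk _).symm]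
    rfl
  rw [hX, ← h]
  exact hd

variable {F}

lemma isTauFunctor (hψ : F.IsCocycle ψ) (hC : IsSemisimple R H C) (hS : IsSimple R H S)
    (hg : HasDegree R τ g S) : IsTauFunctor R τ (functor (hL := hL) (g := g) hψ) where
  additive := ⟨fun {X Y p q} => map_add (F.mapHom X Y) p q⟩
  linear := ⟨fun {X Y} p r => map_smul (F.mapHom X Y) r p⟩
  map_mem h X Y p hp := by
    have hp' : (p : SCat.SHom X Y) ∈
      (Finsupp.supported R R {p | p.1 = h} : Submodule R (SCat.SHom X Y)) := hp
    change F.mapHom X Y p ∈ homDeg R h _ _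
    rw [Finsupp.supported_eq_span_single] at hp'
    refine (Submodule.span_le (p := (homDeg R h _ _).comap (F.mapHom X Y))).2 ?_ hp'
    rintro _ ⟨b, rfl, rfl⟩
    change F.mapHom X Y (Finsupp.single b 1) ∈ homDeg R b.1 _ _
    rw [mapHom_single, one_smul]
    exact F.f_mem _ _
  obj_degree d X hX := by
    obtain rfl : X.deg = d := hX
    exact F.hasDegree_shift hC hS hg X

end ShiftFrame

/-- A semisimple category is generated by the shifts of a representative collection of simple
objects. -/
lemma IsSimpleReps.isGenerating [Nontrivial R] [TauGraded R τ C] (hC : IsSemisimple R H C)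
    {I : Type w} {S : I → C} (hS : IsSimpleReps R H S) {g : I → G}
    (hg : ∀ i, HasDegree R τ (g i) (S i)) {hL : ∀ i, shiftStab R (H := H) (S i) ≤ τ.ker}
    {F : ∀ i, ShiftFrame R H (S i)} {ψ : ∀ i, NormCocycle R (shiftStab R (H := H) (S i))}
    (hψ : ∀ i, (F i).IsCocycle (ψ i)) :
    IsGenerating R τ fun i => ShiftFrame.functor (hL := hL i) (g := g i) (hψ i) where
  tau i := ShiftFrame.isTauFunctor (hψ i) hC (hS.simple i) (hg i)
  full i := ⟨fun {X Y} => (F i).mapHom_surjective hC (hS.simple i) X Y⟩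
  faithful i := ⟨fun {X Y} => @((F i).mapHom_injective (hS.simple i) X Y)⟩
  cross {i j} hij X Y f := by
    refine eq_zero_of_forall_homDeg (R := R) (H := H) (fun a k hk => ?_) f
    by_contra hk₀
    have h := hC.isShift_of_ne_zero ((F i).isSimple_shift (hS.simple i) _)
      ((F j).isSimple_shift (hS.simple j) _) hk hk₀
    -- A nonzero morphism would link `S i` and `S j` by a chain of shifts, against the choice of
    -- representatives.
    exact hij (hS.inj i j ⟨_, (((F i).isShift X.coset).trans h).trans
      ((F j).isShift Y.coset).symm⟩)
  decomp X := by
    obtain ⟨-, T, hT, -, hdec⟩ := hC.2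
    obtain ⟨n, Y, hY, hX⟩ := hdec ⟨X⟩
    obtain ⟨d⟩ := nonempty_degOneSum_iff.2 hX
    -- Each simple summand is a shift of some `S i` by some `a`, hence isomorphic in degree 1 to the
    -- frame object at the coset of `a`.
    choose i a hia using fun j => hS.surj (Y j).obj (hT _ (hY j))
    refine ⟨Fin n, inferInstance, fun j => ⟨i j, ⟨QuotientGroup.mk (a j)⟩⟩,
      d.congr (fun j => ?_) (IsShift.refl X)⟩
    exact (isShift_iff_smul_eq rfl ((F (i j)).rep_mk _) (hia j) ((F (i j)).isShift _) 1).2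
      (one_smul _ _)
  sums Y := by
    have := hC.2.1
    exact exists_degOneSum_of_hasFiniteBiproducts Y

variable (R H C) in
/-- Representatives of the simple objects up to isomorphism of arbitrary degree exist. -/
lemma exists_isSimpleReps : ∃ (I : Type u) (S : I → C), IsSimpleReps R H S := by
  let s : Setoid {X : C // IsSimple R H X} :=
    { r := fun X Y => GenIso R H X.1 Y.1
      iseqv := ⟨fun X => ⟨1, IsShift.refl _⟩, fun ⟨a, h⟩ => ⟨a⁻¹, h.symm⟩,
        fun ⟨a, h⟩ ⟨b, h'⟩ => ⟨b * a, h.trans h'⟩⟩ }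
  refine ⟨Quotient s, fun q => q.out.1, fun q => q.out.2, fun p q h => ?_, fun X hX => ?_⟩
  · rw [← Quotient.out_eq p, ← Quotient.out_eq q]
    exact Quotient.sound h
  · exact ⟨Quotient.mk s ⟨X, hX⟩, Quotient.mk_out (s := s) ⟨X, hX⟩⟩

variable (τ) in
/-- The classification of semisimple `τ`-graded categories by their simple objects. -/
lemma IsSemisimple.classification [Nontrivial R] [TauGraded R τ C] (hC : IsSemisimple R H C)
    {I : Type w} {S : I → C} (hS : IsSimpleReps R H S) :
    ∃ (g : I → G) (hL : ∀ i, shiftStab R (H := H) (S i) ≤ τ.ker),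
      (∀ i x, HasDegree R τ x (S i) ↔ x = g i) ∧
      (∀ i, Nonempty (ShiftFrame R H (S i))) ∧
      ∀ F : ∀ i, ShiftFrame R H (S i),
        (∀ i, ∃! ψ : NormCocycle R (shiftStab R (H := H) (S i)), (F i).IsCocycle ψ) ∧
        ∀ ψ : ∀ i, NormCocycle R (shiftStab R (H := H) (S i)),
          (∀ i, (F i).IsCocycle (ψ i)) →
            TauEquivalent R τ C
              (BoxSum fun i => MTau τ R (shiftStab R (H := H) (S i)) (hL i) (ψ i) (g i)) := by
  choose g hg using fun i => hC.exists_hasDegree (τ := τ) (hS.simple i)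
  refine ⟨g, fun i a ha => ?_, fun i x => ⟨fun hx => ?_, fun hx => hx ▸ hg i⟩,
    fun i => exists_shiftFrame hC (hS.simple i), fun F => ⟨fun i =>
      (F i).existsUnique_isCocycle (hS.simple i), fun ψ hψ => ?_⟩⟩
  · have := ((mem_shiftStab_iff H).1 ha).eq_mul (hS.simple i) (hg i) (hg i)
    rw [MonoidHom.mem_ker]
    simpa using this
  · simpa using (IsShift.refl (R := R) (H := H) (S i)).eq_mul (hS.simple i) (hg i) hx
  · exact (hS.isGenerating hC hg hψ).tauEquivalent isGenerating_boxSum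

end FrameFunctor

end

end TauGrad

/-! ### The classification theorem -/

open TauGrad
theorem theorem3
    {R : Type uR} [CommRing R] [Nontrivial R] {H : Type uH} [Group H] {G : Type uG} [Group G]
    (τ : H →* G) (C : Type u) [Category.{v} C] [Preadditive C] [Linear R C] [HomGraded R H C]
    [TauGraded R τ C] :
    (IsSemisimple R H C ↔
      ∃ (I : Type u) (L : I → Subgroup H) (hL : ∀ i, L i ≤ τ.ker)
        (ψ : ∀ i, NormCocycle R (L i)) (g : I → G),
        TauEquivalent R τ C (BoxSum fun i => MTau τ R (L i) (hL i) (ψ i) (g i))) ∧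
    (IsSemisimple R H C →
      ∀ (I : Type w) (S : I → C), IsSimpleReps R H S →
        ∃ (g : I → G) (hL : ∀ i, shiftStab R (H := H) (S i) ≤ τ.ker),
          (∀ i x, HasDegree R τ x (S i) ↔ x = g i) ∧
          (∀ i, Nonempty (ShiftFrame R H (S i))) ∧
          ∀ F : ∀ i, ShiftFrame R H (S i),
            (∀ i, ∃! ψ : NormCocycle R (shiftStab R (H := H) (S i)), (F i).IsCocycle ψ) ∧
            ∀ ψ : ∀ i, NormCocycle R (shiftStab R (H := H) (S i)),
              (∀ i, (F i).IsCocycle (ψ i)) →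
                TauEquivalent R τ C
                  (BoxSum fun i => MTau τ R (shiftStab R (H := H) (S i)) (hL i) (ψ i) (g i))) := by
  refine ⟨⟨fun hC => ?_, fun ⟨I, L, hL, ψ, g, h⟩ => ?_⟩, fun hC I S hS => hC.classification τ hS⟩
  · obtain ⟨I, S, hS⟩ := exists_isSimpleReps R H C
    obtain ⟨g, hL, -, hF, h⟩ := hC.classification τ hS
    obtain ⟨h₁, h₂⟩ := h fun i => (hF i).some
    choose ψ hψ using fun i => (h₁ i).exists
    exact ⟨I, _, hL, ψ, g, h₂ ψ hψ⟩
  · obtain ⟨P, hP⟩ := isGenerating_boxSum.of_tauEquivalent h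
    exact hP.isSemisimple
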